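/- Consider constrained-deadline sporadic task systems $\tau=\{\tau_1,\dots,\tau_n\}$ with worst-case execution times $C_i>0$, minimum inter-arrival times (periods) $T_i>0$, relative deadlines $0<D_i\le T_i$ and utilizations $U_i=C_i/T_i$, indexed by deadline-monotonic priority: $D_1\le\dots\le D_n$, and $\tau_i$ has higher priority than $\tau_j$ if $i<j$. The tasks are executed preemptively on $M\ge1$ identical processors; jobs may migrate, no job executes on two processors at once, and the jobs of a task are executed in sequence. Under global DM, at any time the $M$ highest-priority ready jobs (all of them, if there are fewer) are executed. Processors have speed $1$ unless stated otherwise. Let $\Delta_k^{\max}=\max\{U_1,\dots,U_{k-1},C_k/D_k\}$. Say that $\tau_k$ passes the test if $\sum_{i=1}^{k}U_i\le M$, $\sum_{i=1}^{k-1}\frac{C_i}{D_k}\le M$ and $$\Delta_k^{\max}\le 1-\frac1M\sum_{i=1}^{k-1}\Big(U_i+\frac{C_i}{D_k}\Big)+\frac1{M^2}\sum_{i=1}^{k-1}U_{\pi(i)}\sum_{\ell=i}^{k-1}\frac{C_{\pi(\ell)}}{D_k},$$ where $\pi$ orders the $k-1$ higher-priority tasks by non-increasing period, $T_{\pi(1)}\ge\dots\ge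 T_{\pi(k-1)}$. Then: 1. The test can be decided in time polynomial in $k$ (counting real arithmetic operations and comparisons, array accesses and index operations as unit steps), by one program for all task systems, $k$ and $M$. 2. It is a sufficient schedulability test: if $\tau_1,\dots,\tau_{k-1}$ are schedulable by global DM on $M$ processors and $\tau_k$ passes the test, then $\tau_k$ is schedulable by global DM on $M$ processors (all its jobs meet their deadlines, for every legal job arrival sequence). 3. If $\tau_k$ fails the test, then $\Delta_k^{\max}>\frac13$, or $\frac1M\sum_{i=1}^{k-1}U_i>\frac13$, or $\frac1{MD_k}\sum_{i=1}^{k-1}C_i>\frac13$. 4. (Capacity augmentation factor 3.) If $\sum_{i=1}^{n}\frac{C_i}{MT_i}\le\frac13$, $\frac{C_k+\sum_{i=1}^{k-1}C_i}{MD_k}\le\frac13$ for every $k$, and $\frac{C_i}{\min\{T_i,D_i\}}\le\frac13$ for every $i$, then every task passes the test and the system is schedulable by global DM on $M$ processors. 5. (Speed-up factor 3.) If some task fails the test, then the system is not feasible on $M$ processors of speed $\frac13$: for some legal job arrival sequence no schedule meets all deadlines. If the system is feasible on $M$ processors of speed $1$, then it is schedulable by global DM on $M$ processors of speed $3$. 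-/

import Mathlib

open MeasureTheory

namespace GlobalDM

noncomputable section

/-! ### Sporadic task systems with constrained deadlines -/

/-- A constrained-deadline sporadic task system with `n` tasks: worst-case execution times `C`,
minimum inter-arrival times (periods) `T`, relative deadlines `D ≤ T`.
The index is the priority: a task with a smaller index has higher priority. -/
structure TaskSystem (n : ℕ) where
  C : Fin n → ℝ
  T : Fin n → ℝ
  D : Fin n → ℝ
  C_pos : ∀ i, 0 < C i
  T_pos : ∀ i, 0 < T i
  D_pos : ∀ i, 0 < D i
  D_le_T : ∀ i, D i ≤ T i

namespace TaskSystem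

variable {n : ℕ}

/-- Utilization. -/
def U (τ : TaskSystem n) (i : Fin n) : ℝ := τ.C i / τ.T i

/-- The priority order (given by the index) is a deadline-monotonic one. Ties between equal
relative deadlines are broken in an arbitrary but fixed way. -/
def DeadlineMonotonic (τ : TaskSystem n) : Prop := ∀ i j : Fin n, i ≤ j → τ.D i ≤ τ.D j

end TaskSystem

/-! ### Job arrivals -/

/-- A legal job arrival sequence of the task system: the `j`-th job of task `i` is released at
`release i j`, consecutive releases are at least `T i` apart, and it needs `exec i j` units of
execution, at most the worst-case execution time `C i`. -/
structure Arrivals {n : ℕ} (τ : TaskSystem n) where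
  release : Fin n → ℕ → ℝ
  exec : Fin n → ℕ → ℝ
  release_nonneg : ∀ i, 0 ≤ release i 0
  release_sep : ∀ i j, release i j + τ.T i ≤ release i (j + 1)
  exec_nonneg : ∀ i j, 0 ≤ exec i j
  exec_le : ∀ i j, exec i j ≤ τ.C i

/-! ### Schedules on identical processors -/

/-- A job: its task and its number. -/
abbrev Job (n : ℕ) : Type := Fin n × ℕ

/-- A (preemptive, migrating) schedule on `M` processors: at every time each processor is idle or
executes a job; the set of times at which it executes a given job is measurable. -/
structure Schedule (n M : ℕ) where
  proc : Fin M → ℝ → Option (Job n)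
  measurable : ∀ p J, MeasurableSet {t | proc p t = some J}

namespace Schedule

variable {n M : ℕ}

/-- Job `J` is executed on some processor at time `t`. -/
def Runs (σ : Schedule n M) (J : Job n) (t : ℝ) : Prop := ∃ p, σ.proc p t = some J

/-- Amount of execution that job `J` has received in `[0, t)` from processors of speed `s`. -/
def service (σ : Schedule n M) (s : ℝ) (J : Job n) (t : ℝ) : ℝ :=
  s * volume.real {x | x ∈ Set.Ico (0 : ℝ) t ∧ σ.Runs J x}

/-- Job `J` has finished by time `t`. -/
def Finished (σ : Schedule n M) (s : ℝ) {τ : TaskSystem n} (A : Arrivals τ)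
    (J : Job n) (t : ℝ) : Prop :=
  A.exec J.1 J.2 ≤ σ.service s J t

/-- Job `J` is in the ready queue at time `t`: it has been released, it has not finished, and all
earlier jobs of the same task have finished. -/
def Ready (σ : Schedule n M) (s : ℝ) {τ : TaskSystem n} (A : Arrivals τ)
    (J : Job n) (t : ℝ) : Prop :=
  A.release J.1 J.2 ≤ t ∧ ¬ σ.Finished s A J t ∧ ∀ j < J.2, σ.Finished s A (J.1, j) t

/-- Validity: only ready jobs are executed, and no job is executed on two processors at once. -/
def IsValid (σ : Schedule n M) (s : ℝ) {τ : TaskSystem n} (A : Arrivals τ) : Prop :=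
  ∀ t : ℝ, 0 ≤ t →
    (∀ J, σ.Runs J t → σ.Ready s A J t) ∧
    (∀ p q J, σ.proc p t = some J → σ.proc q t = some J → p = q)

/-- The schedule is produced by global fixed-priority scheduling: at any time the (at most) `M`
highest-priority ready jobs are executed, i.e. a ready job is left waiting only while all
processors execute jobs of higher priority. -/
def IsGlobalFixedPriority (σ : Schedule n M) (s : ℝ) {τ : TaskSystem n} (A : Arrivals τ) : Prop :=
  σ.IsValid s A ∧
    ∀ t : ℝ, 0 ≤ t → ∀ J, σ.Ready s A J t → ¬ σ.Runs J t →
      ∀ p, ∃ J', σ.proc p t = some J' ∧ J'.1 < J.1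

/-- All jobs of task `k` meet their deadlines. -/
def TaskMeetsDeadlines (σ : Schedule n M) (s : ℝ) {τ : TaskSystem n} (A : Arrivals τ)
    (k : Fin n) : Prop :=
  ∀ j, σ.Finished s A (k, j) (A.release k j + τ.D k)

end Schedule

namespace TaskSystem

variable {n : ℕ}

/-- Task `k` is schedulable by global fixed-priority scheduling on `M` processors of speed `s`:
whatever the arrivals, all its jobs meet their deadlines. -/
def TaskSchedulable (τ : TaskSystem n) (M : ℕ) (s : ℝ) (k : Fin n) : Prop :=
  ∀ (A : Arrivals τ) (σ : Schedule n M), σ.IsGlobalFixedPriority s A → σ.TaskMeetsDeadlines s A k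

/-- The task system is schedulable by global fixed-priority scheduling on `M` processors of
speed `s` (by global DM, when the priorities are deadline-monotonic). -/
def Schedulable (τ : TaskSystem n) (M : ℕ) (s : ℝ) : Prop := ∀ k, τ.TaskSchedulable M s k

/-- The task system is feasible on `M` processors of speed `s`: for all arrivals there is some
valid schedule, by whatever algorithm, that meets all deadlines. -/
def Feasible (τ : TaskSystem n) (M : ℕ) (s : ℝ) : Prop :=
  ∀ A : Arrivals τ, ∃ σ : Schedule n M, σ.IsValid s A ∧ ∀ k, σ.TaskMeetsDeadlines s A k

/-! ### The schedulability test -/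

/-- `Δ_k^max`, the maximum of `C_k / D_k` and the utilizations of the tasks before `k`. -/
def deltaMax (τ : TaskSystem n) (k : Fin n) : ℝ :=
  (Finset.Iio k).fold max (τ.C k / τ.D k) τ.U

/-- The higher-priority tasks of `k`, in a non-increasing order of their periods. -/
def hpByPeriod (τ : TaskSystem n) (k : Fin n) (i : Fin k.val) : Fin n :=
  Fin.castLE k.isLt.le (Tuple.sort (fun j : Fin k.val => -τ.T (Fin.castLE k.isLt.le j)) i)

theorem hpByPeriod_injective (τ : TaskSystem n) (k : Fin n) :
    Function.Injective (τ.hpByPeriod k) :=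
  (Fin.castLE_injective k.isLt.le).comp (Equiv.injective _)

theorem range_hpByPeriod (τ : TaskSystem n) (k : Fin n) :
    Set.range (τ.hpByPeriod k) = Set.Iio k := by
  ext x
  constructor
  · rintro ⟨i, rfl⟩
    exact Fin.lt_def.2
      (Tuple.sort (fun j : Fin k.val => -τ.T (Fin.castLE k.isLt.le j)) i).isLt
  · intro hx
    refine ⟨(Tuple.sort (fun j : Fin k.val => -τ.T (Fin.castLE k.isLt.le j))).symm
      ⟨x.val, Fin.lt_def.1 hx⟩, ?_⟩
    simp [hpByPeriod]

theorem hpByPeriod_antitone (τ : TaskSystem n) (k : Fin n) :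
    Antitone (fun i => τ.T (τ.hpByPeriod k i)) := by
  intro i j hij
  have h := Tuple.monotone_sort (fun j : Fin k.val => -τ.T (Fin.castLE k.isLt.le j)) hij
  exact neg_le_neg_iff.1 h

/-- The schedulability test for task `k` under global fixed-priority scheduling on
`M` processors. -/
def PassesTest (τ : TaskSystem n) (M : ℕ) (k : Fin n) : Prop :=
  ∑ i ∈ Finset.Iic k, τ.U i ≤ M ∧
  ∑ i ∈ Finset.Iio k, τ.C i / τ.D k ≤ M ∧
  τ.deltaMax k ≤
    1 - 1 / (M : ℝ) * ∑ i ∈ Finset.Iio k, (τ.U i + τ.C i / τ.D k)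
      + 1 / (M : ℝ) ^ 2 * ∑ i : Fin k.val, τ.U (τ.hpByPeriod k i) *
          ∑ l ∈ Finset.Ici i, τ.C (τ.hpByPeriod k l) / τ.D k

/-- The three constraints that define a capacity augmentation factor `b` on `M` processors:
total utilization, density of each task with its higher-priority tasks, maximum utilization. -/
def CapacityConstraints (τ : TaskSystem n) (M : ℕ) (b : ℝ) : Prop :=
  ∑ i, τ.C i / (M * τ.T i) ≤ 1 / b ∧
  (∀ k, (τ.C k + ∑ i ∈ Finset.Iio k, τ.C i) / (M * τ.D k) ≤ 1 / b) ∧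
  (∀ i, τ.C i / min (τ.T i) (τ.D i) ≤ 1 / b)

end TaskSystem

/-! ### Running times: programs of a real random-access machine

There are real registers, natural-number index registers and real arrays. Each instruction
performs at most one real operation or comparison and costs one step. The control structures are
sequencing, branching and counting loops. The only real constants are `0` and `1`. -/

structure State where
  reg : ℕ → ℝ
  idx : ℕ → ℕ
  mem : ℕ → ℕ → ℝ

inductive Program : Type
  /-- no operation -/
  | skip : Program
  /-- `reg r := 0` -/
  | zero (r : ℕ) : Program
  /-- `reg r := 1` -/
  | one (r : ℕ) : Program
  /-- `reg r := reg a + reg b` -/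
  | add (r a b : ℕ) : Program
  /-- `reg r := reg a - reg b` -/
  | sub (r a b : ℕ) : Program
  /-- `reg r := reg a * reg b` -/
  | mul (r a b : ℕ) : Program
  /-- `reg r := reg a / reg b` -/
  | div (r a b : ℕ) : Program
  /-- `reg r := mem a [idx i]` -/
  | load (r a i : ℕ) : Program
  /-- `mem a [idx i] := reg r` -/
  | store (a i r : ℕ) : Program
  /-- `idx i := 0` -/
  | idxZero (i : ℕ) : Program
  /-- `idx i := idx i + 1` -/
  | idxSucc (i : ℕ) : Program
  /-- `idx i := idx j` -/
  | idxCopy (i j : ℕ) : Program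
  /-- `P; Q` -/
  | seq (P Q : Program) : Program
  /-- if `reg a ≤ reg b` then `P` else `Q` -/
  | ifLe (a b : ℕ) (P Q : Program) : Program
  /-- if `idx i ≤ idx j` then `P` else `Q` -/
  | ifIdxLe (i j : ℕ) (P Q : Program) : Program
  /-- for `idx i = 0, 1, …, b - 1` do `P`, where `b` is the value of `idx j` on entry -/
  | loop (i j : ℕ) (P : Program) : Program

namespace State

def setReg (s : State) (r : ℕ) (x : ℝ) : State := { s with reg := Function.update s.reg r x }

def setIdx (s : State) (i : ℕ) (m : ℕ) : State := { s with idx := Function.update s.idx i m }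

def setMem (s : State) (a m : ℕ) (x : ℝ) : State :=
  { s with mem := Function.update s.mem a (Function.update (s.mem a) m x) }

end State

namespace Program

open Classical in
/-- The final state and the number of steps of a run. -/
def run : Program → State → State × ℕ
  | skip, s => (s, 1)
  | zero r, s => (s.setReg r 0, 1)
  | one r, s => (s.setReg r 1, 1)
  | add r a b, s => (s.setReg r (s.reg a + s.reg b), 1)
  | sub r a b, s => (s.setReg r (s.reg a - s.reg b), 1)
  | mul r a b, s => (s.setReg r (s.reg a * s.reg b), 1)
  | div r a b, s => (s.setReg r (s.reg a / s.reg b), 1)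
  | load r a i, s => (s.setReg r (s.mem a (s.idx i)), 1)
  | store a i r, s => (s.setMem a (s.idx i) (s.reg r), 1)
  | idxZero i, s => (s.setIdx i 0, 1)
  | idxSucc i, s => (s.setIdx i (s.idx i + 1), 1)
  | idxCopy i j, s => (s.setIdx i (s.idx j), 1)
  | seq P Q, s => ((Q.run (P.run s).1).1, (P.run s).2 + (Q.run (P.run s).1).2)
  | ifLe a b P Q, s =>
      if s.reg a ≤ s.reg b then ((P.run s).1, (P.run s).2 + 1) else ((Q.run s).1, (Q.run s).2 + 1)
  | ifIdxLe i j P Q, s =>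
      if s.idx i ≤ s.idx j then ((P.run s).1, (P.run s).2 + 1) else ((Q.run s).1, (Q.run s).2 + 1)
  | loop i j P, s =>
      Nat.rec (motive := fun _ => State × ℕ) (s, 1)
        (fun m acc => ((P.run (acc.1.setIdx i m)).1, acc.2 + (P.run (acc.1.setIdx i m)).2 + 1))
        (s.idx j)

end Program

/-- The input of the test for task `k`: index register `0` holds `k` (the number of
higher-priority tasks), real register `0` holds `M`, and the arrays `0`, `1`, `2` hold the
parameters `C`, `T`, `D`; everything else is `0`. -/
def inputState {n : ℕ} (τ : TaskSystem n) (M : ℕ) (k : Fin n) : State where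
  reg r := if r = 0 then (M : ℝ) else 0
  idx i := if i = 0 then k.val else 0
  mem a m := if h : m < n then
      (if a = 0 then τ.C ⟨m, h⟩ else if a = 1 then τ.T ⟨m, h⟩ else if a = 2 then τ.D ⟨m, h⟩ else 0)
    else 0

/-- The program decides the test, for all task systems, tasks and numbers of processors, in
polynomial time: it leaves `1` in real register `0` if the task passes and `0` if it does not,
after a number of steps that is bounded by a polynomial in the position `k + 1` of the task (the
number of tasks that the test involves). -/
def Program.DecidesTestInPolynomialTime (P : Program) : Prop :=
  ∃ c d : ℕ, ∀ (n : ℕ) (τ : TaskSystem n) (M : ℕ) (k : Fin n), 0 < M →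
    (τ.PassesTest M k → (P.run (inputState τ M k)).1.reg 0 = 1) ∧
    (¬ τ.PassesTest M k → (P.run (inputState τ M k)).1.reg 0 = 0) ∧
    (P.run (inputState τ M k)).2 ≤ c * (k.val + 1) ^ d

end

end GlobalDM

open GlobalDM

open GlobalDM

namespace GlobalDM

/-! Sufficiency. Let δ be `deltaMax`, and let a job of task k, released at r, be the first of its
task to miss its deadline d. It runs for less than C_k ≤ δ D_k, so the higher-priority tasks use
more than a fraction 1 - δ of the capacity of [r, d). Move the left end back to the t₀ in [0, r]
that maximizes M(1 - δ)t minus the higher-priority work done in [0, t). Then [t₀, d) is still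
overloaded, while no interval ending at t₀ is. Hence a job released before t₀ and unfinished at t₀
has run for at least a fraction δ ≥ U_i of the time since its release, and task i does at most C_i +
U_i y_i work in the window, where t₀ + y_i is its last release there, or y_i = 0 if there is none
(`IsValid.exists_work_bound`). Each offset y_j gives a further inequality: the work after t₀ + y_j
is at most the full capacity, so much of it must precede that point. Weighting these by U_j and
adding them (`quadratic_bound`) contradicts the test, whichever order the y_i have, because the
order by non-increasing period is the extremal one (`sum_div_max_le`).

In that order the double sum of the test is the sum of C_i C_l / max(T_i, T_l) over unordered pairs.
Hence the program needs no sorting: two nested loops collect all the sums.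

Factor 3. If the three quantities are at most 1/3, the right-hand side of the test is at least 1 -
1/3 - 1/3 (`passesTest_of_le`). Feasibility at speed 1/3 forces these three bounds, and multiplying
execution times and speed by the same factor leaves every schedule as it is, which carries speed 1/3
to 1 and 1 to 3. -/

/-! ### Pair sums and the extremal order of the periods -/

/-- Add the triangular sum to its transpose: an off-diagonal pair survives in exactly one of them,
with the larger period in the denominator, and the diagonal survives in both. -/
theorem two_mul_sum_Ici_eq {ι : Type*} [Fintype ι] [LinearOrder ι] [LocallyFiniteOrderTop ι]
    (C T : ι → ℝ) (hT : Antitone T) :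
    2 * ∑ i, C i / T i * ∑ l ∈ Finset.Ici i, C l =
      ∑ i, ∑ l, C i * C l / max (T i) (T l) + ∑ i, C i * (C i / T i) := by
  have h1 : ∑ i, C i / T i * ∑ l ∈ Finset.Ici i, C l =
      ∑ i, ∑ l, if i ≤ l then C i / T i * C l else 0 := by
    refine Finset.sum_congr rfl fun i _ => ?_
    rw [Finset.mul_sum, ← Finset.sum_filter]
    exact Finset.sum_congr (by ext l; simp) fun _ _ => rfl
  have h2 : ∑ i, C i * (C i / T i) =
      ∑ i, ∑ l, if i = l then C i * (C i / T i) else 0 :=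
    Finset.sum_congr rfl fun i _ => by simp
  have h3 := Finset.sum_comm (s := (Finset.univ : Finset ι)) (t := (Finset.univ : Finset ι))
    (f := fun i l => if i ≤ l then C i / T i * C l else 0)
  rw [two_mul, h1]
  nth_rewrite 2 [h3]
  rw [h2, ← Finset.sum_add_distrib, ← Finset.sum_add_distrib]
  refine Finset.sum_congr rfl fun i _ => ?_
  rw [← Finset.sum_add_distrib, ← Finset.sum_add_distrib]
  refine Finset.sum_congr rfl fun l _ => ?_
  rcases lt_trichotomy i l with h | h | h
  · rw [if_pos h.le, if_neg h.not_ge, if_neg h.ne, max_eq_left (hT h.le)]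
    ring
  · subst h
    simp only [le_refl, if_true, max_self]
    ring
  · rw [if_neg h.not_ge, if_pos h.le, if_neg h.ne', max_eq_right (hT h.le)]
    ring

/-- Any `y` orders each pair in at least one direction, and either direction contributes at least
the term with the larger period. Ties only increase the right-hand side. -/
theorem sum_div_max_le {ι : Type*} [DecidableEq ι] (s : Finset ι) (C T y : ι → ℝ)
    (hC : ∀ i, 0 < C i) (hT : ∀ i, 0 < T i) :
    ∑ i ∈ s, ∑ l ∈ s, C i * C l / max (T i) (T l) + ∑ i ∈ s, C i * (C i / T i) ≤
      2 * ∑ i ∈ s, ∑ l ∈ s, if y i ≤ y l then C i / T i * C l else 0 := by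
  have h2 : ∑ i ∈ s, C i * (C i / T i) =
      ∑ i ∈ s, ∑ l ∈ s, if i = l then C i * (C i / T i) else 0 :=
    Finset.sum_congr rfl fun i hi => by simp [hi]
  rw [two_mul]
  nth_rewrite 2 [Finset.sum_comm]
  rw [h2, ← Finset.sum_add_distrib, ← Finset.sum_add_distrib]
  refine Finset.sum_le_sum fun i _ => ?_
  rw [← Finset.sum_add_distrib, ← Finset.sum_add_distrib]
  refine Finset.sum_le_sum fun l _ => ?_
  have hCi := hC i
  have hCl := hC l
  have hTi := hT i
  have hTl := hT l
  have a1 : C i * C l / max (T i) (T l) ≤ C i / T i * C l := by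
    rw [div_mul_eq_mul_div]
    exact div_le_div_of_nonneg_left (by positivity) hTi (le_max_left _ _)
  have a2 : C i * C l / max (T i) (T l) ≤ C l / T l * C i := by
    rw [div_mul_eq_mul_div, mul_comm (C l)]
    exact div_le_div_of_nonneg_left (by positivity) hTl (le_max_right _ _)
  by_cases h : i = l
  · subst h
    simp only [le_refl, if_true]
    linarith [mul_comm (C i) (C i / T i)]
  · rw [if_neg h, add_zero]
    have p1 : 0 ≤ C i / T i * C l := by positivity
    have p2 : 0 ≤ C l / T l * C i := by positivity
    rcases le_total (y i) (y l) with hy | hy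
    · rw [if_pos hy]
      split_ifs <;> linarith
    · rw [if_pos hy]
      split_ifs <;> linarith

/-! ### The test without an ordering of the periods -/

namespace TaskSystem

variable {n : ℕ} (τ : TaskSystem n)

theorem U_pos (i : Fin n) : 0 < τ.U i := div_pos (τ.C_pos i) (τ.T_pos i)

theorem U_le_density (i : Fin n) : τ.U i ≤ τ.C i / τ.D i :=
  div_le_div_of_nonneg_left (τ.C_pos i).le (τ.D_pos i) (τ.D_le_T i)

/-- Twice the sum of `C i * C j / max (T i) (T j)` over the unordered pairs of tasks before `k`,
the pairs with `i = j` included. -/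
noncomputable def pairSum (k : Fin n) : ℝ :=
  ∑ i ∈ Finset.Iio k, ∑ j ∈ Finset.Iio k, τ.C i * τ.C j / max (τ.T i) (τ.T j) +
    ∑ i ∈ Finset.Iio k, τ.C i * (τ.C i / τ.T i)

theorem sum_hpByPeriod (k : Fin n) (f : Fin n → ℝ) :
    ∑ i, f (τ.hpByPeriod k i) = ∑ i ∈ Finset.Iio k, f i := by
  rw [← Finset.sum_image (s := Finset.univ) (f := f) (g := τ.hpByPeriod k)
    (fun a _ b _ h => τ.hpByPeriod_injective k h)]
  refine Finset.sum_congr ?_ fun _ _ => rfl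
  rw [← Finset.coe_inj, Finset.coe_image, Finset.coe_univ, Set.image_univ, range_hpByPeriod,
    Finset.coe_Iio]

theorem two_mul_sum_hpByPeriod_eq (k : Fin n) :
    2 * ∑ i : Fin k.val, τ.U (τ.hpByPeriod k i) *
          ∑ l ∈ Finset.Ici i, τ.C (τ.hpByPeriod k l) / τ.D k = τ.pairSum k / τ.D k := by
  have h := two_mul_sum_Ici_eq (fun i => τ.C (τ.hpByPeriod k i)) (fun i => τ.T (τ.hpByPeriod k i))
    (τ.hpByPeriod_antitone k)
  have e1 : τ.pairSum k = ∑ i, ∑ l, τ.C (τ.hpByPeriod k i) * τ.C (τ.hpByPeriod k l) /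
      max (τ.T (τ.hpByPeriod k i)) (τ.T (τ.hpByPeriod k l)) +
      ∑ i, τ.C (τ.hpByPeriod k i) * (τ.C (τ.hpByPeriod k i) / τ.T (τ.hpByPeriod k i)) := by
    simp only [pairSum, ← sum_hpByPeriod τ k]
  rw [e1, ← h, mul_div_assoc, Finset.sum_div]
  congr 1
  refine Finset.sum_congr rfl fun i _ => ?_
  rw [← Finset.sum_div, U]
  ring

theorem pairSum_nonneg (k : Fin n) : 0 ≤ τ.pairSum k := by
  have hC := fun i => (τ.C_pos i).le
  have hT := fun i => (τ.T_pos i).le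
  exact add_nonneg (Finset.sum_nonneg fun i _ => Finset.sum_nonneg fun j _ =>
      div_nonneg (mul_nonneg (hC i) (hC j)) (le_max_of_le_left (hT i)))
    (Finset.sum_nonneg fun i _ => mul_nonneg (hC i) (div_nonneg (hC i) (hT i)))

theorem deltaMax_le_iff (k : Fin n) (x : ℝ) :
    τ.deltaMax k ≤ x ↔ τ.C k / τ.D k ≤ x ∧ ∀ i < k, τ.U i ≤ x := by
  rw [deltaMax, Finset.fold_max_le]
  simp

/-- The schedulability test in terms of sums that do not depend on an order of the periods. -/
theorem passesTest_iff (M : ℕ) (k : Fin n) :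
    τ.PassesTest M k ↔
      ∑ i ∈ Finset.Iio k, τ.U i + τ.U k ≤ M ∧
      (∑ i ∈ Finset.Iio k, τ.C i) / τ.D k ≤ M ∧
      τ.deltaMax k ≤
        1 - (∑ i ∈ Finset.Iio k, τ.U i + (∑ i ∈ Finset.Iio k, τ.C i) / τ.D k) / M +
          τ.pairSum k / τ.D k / 2 / (M * M) := by
  have e : ∑ i ∈ Finset.Iic k, τ.U i = ∑ i ∈ Finset.Iio k, τ.U i + τ.U k := by
    rw [← Finset.Iio_insert, Finset.sum_insert (by simp), add_comm]
  rw [PassesTest, e, ← Finset.sum_div, Finset.sum_add_distrib, ← Finset.sum_div,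
    ← two_mul_sum_hpByPeriod_eq, mul_div_cancel_left₀ _ (two_ne_zero' ℝ), one_div_mul_eq_div,
    one_div_mul_eq_div, sq]

end TaskSystem

/-! ### From window inequalities to the quadratic bound -/

/-- The quadratic schedulability bound: a window of length `L` in which the tasks of `s` do more
work than a fraction `1 - δ` of the capacity rules out that `δ` is small. -/
theorem quadratic_bound {ι : Type*} [DecidableEq ι] (s : Finset ι) (C T y : ι → ℝ)
    (hC : ∀ i, 0 < C i) (hT : ∀ i, 0 < T i) {M δ L D : ℝ} (hM : 0 < M) (hD : 0 < D) (hDL : D ≤ L)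
    (hU : ∑ i ∈ s, C i / T i < M)
    (hwork : M * ((1 - δ) * L) < ∑ i ∈ s, (C i + C i / T i * y i))
    (hpoint : ∀ j ∈ s, M * (y j - δ * L) ≤
      ∑ i ∈ s, ((if y j ≤ y i then 0 else C i) + C i / T i * y i)) :
    1 - (∑ i ∈ s, C i / T i + (∑ i ∈ s, C i) / D) / M +
      (∑ i ∈ s, ∑ l ∈ s, C i * C l / max (T i) (T l) + ∑ i ∈ s, C i * (C i / T i)) /
        D / 2 / (M * M) < δ := by
  have hU0 : ∀ i, 0 < C i / T i := fun i => div_pos (hC i) (hT i)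
  set P := ∑ i ∈ s, ∑ l ∈ s, C i * C l / max (T i) (T l) + ∑ i ∈ s, C i * (C i / T i)
  set Q := ∑ i ∈ s, ∑ l ∈ s, if y i ≤ y l then C i / T i * C l else 0 with hQ
  have hPQ : P ≤ 2 * Q := sum_div_max_le s C T y hC hT
  set c := ∑ i ∈ s, C i with hc
  set u := ∑ i ∈ s, C i / T i with hu
  set S := ∑ i ∈ s, C i / T i * y i with hS
  have hc0 : 0 ≤ c := Finset.sum_nonneg fun i _ => (hC i).le
  rw [Finset.sum_add_distrib] at hwork
  have hQle : Q ≤ u * c := by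
    rw [hQ, hu, hc, Finset.sum_mul_sum]
    refine Finset.sum_le_sum fun i _ => Finset.sum_le_sum fun l _ => ?_
    split_ifs
    · exact le_rfl
    · exact (mul_pos (hU0 i) (hC l)).le
  -- The inequalities `hpoint`, weighted by the utilizations `C j / T j` and added up. The pairs
  -- with `y j ≤ y i` drop out, which is what subtracts `Q` from `u * c`.
  have hsum : M * S ≤ u * (M * (δ * L) + S) + (u * c - Q) := by
    have h1 : M * S = ∑ j ∈ s, C j / T j * (M * y j) := by
      rw [hS, Finset.mul_sum]
      exact Finset.sum_congr rfl fun i _ => by ring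
    have h2 : ∑ j ∈ s, C j / T j * (M * (δ * L) + S + ∑ i ∈ s, if y j ≤ y i then 0 else C i) =
        u * (M * (δ * L) + S) + (u * c - Q) := by
      simp only [mul_add (_ / _) (_ + _)]
      rw [Finset.sum_add_distrib, ← Finset.sum_mul]
      congr 1
      rw [hQ, hu, hc, Finset.sum_mul_sum, ← Finset.sum_sub_distrib]
      refine Finset.sum_congr rfl fun i _ => ?_
      rw [Finset.mul_sum, ← Finset.sum_sub_distrib]
      refine Finset.sum_congr rfl fun l _ => ?_
      split_ifs <;> ring
    rw [h1, ← h2]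
    refine Finset.sum_le_sum fun j hj => mul_le_mul_of_nonneg_left ?_ (hU0 j).le
    have := hpoint j hj
    rw [Finset.sum_add_distrib] at this
    linarith
  -- Multiply `hwork` by `M - u > 0` and eliminate `S` by `hsum`; the terms `u * c` cancel.
  have key : M * M * ((1 - δ) * L) < M * u * L + M * c - Q := by
    nlinarith [mul_lt_mul_of_pos_left hwork (sub_pos.2 hU)]
  have hL : 0 < L := hD.trans_le hDL
  -- `Q ≤ u * c ≤ M * c`; this sign allows `L` to be replaced by the smaller `D` in the denominator.
  have hneg : 0 ≤ M * c - Q := by nlinarith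
  have key2 : M * M * (1 - δ) * D < M * u * D + M * c - P / 2 := by
    have h1 : M * M * (1 - δ) - M * u < (M * c - Q) / L := by
      rw [lt_div_iff₀ hL]
      linarith
    have h2 : (M * c - Q) / L ≤ (M * c - Q) / D := div_le_div_of_nonneg_left hneg hD hDL
    have h3 := h1.trans_le h2
    rw [lt_div_iff₀ hD] at h3
    linarith
  have e : 1 - (u + c / D) / M + P / D / 2 / (M * M) =
      (M * M * D - M * u * D - M * c + P / 2) / (M * M * D) := by
    field_simp
    ring
  rw [e, div_lt_iff₀ (by positivity)]
  linarith

/-! ### A program that decides the test in quadratic time -/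

namespace Program

/-- The number of iterations is read once on entry, so a Hoare-style invariant indexed by the
iteration suffices. -/
theorem run_loop_of_invariant (i j : ℕ) (P : Program) (s : State) (c : ℕ) (Inv : ℕ → State → Prop)
    (h0 : Inv 0 s)
    (hstep : ∀ m < s.idx j, ∀ s', Inv m s' →
      Inv (m + 1) (P.run (s'.setIdx i m)).1 ∧ (P.run (s'.setIdx i m)).2 ≤ c) :
    Inv (s.idx j) ((loop i j P).run s).1 ∧ ((loop i j P).run s).2 ≤ 1 + s.idx j * (c + 1) := by
  have key : ∀ N ≤ s.idx j, ∀ acc : State × ℕ,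
      acc = Nat.rec (motive := fun _ => State × ℕ) (s, 1)
        (fun m acc => ((P.run (acc.1.setIdx i m)).1, acc.2 + (P.run (acc.1.setIdx i m)).2 + 1)) N →
      Inv N acc.1 ∧ acc.2 ≤ 1 + N * (c + 1) := by
    intro N
    induction N with
    | zero =>
      rintro - acc rfl
      exact ⟨h0, by simp⟩
    | succ N ih =>
      rintro hN acc rfl
      have h1 := ih (by omega) _ rfl
      have h2 := hstep N (by omega) _ h1.1
      refine ⟨h2.1, ?_⟩
      have e : (N + 1) * (c + 1) = N * (c + 1) + (c + 1) := by ring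
      rw [e]
      have h3 := h1.2
      have h4 := h2.2
      dsimp only
      omega
  exact key _ le_rfl _ rfl

/-- Adds `C a * C b / max (T a) (T b)` to real register `7`, where `b` is in index register `2` and
`C a`, `T a` are in real registers `10`, `11`. -/
def addPairTerm : Program :=
  seq (load 20 0 2) <| seq (load 21 1 2) <| seq (mul 22 10 20) <|
    seq (ifLe 11 21 (div 22 22 21) (div 22 22 11)) (add 7 7 22)

/-- For the higher-priority task whose number is in index register `1`: updates the sums of the
utilizations and of the execution times and the maximum of the utilizations in real registers
`4`, `5`, `6`, and adds the diagonal pair term to real register `7`. -/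
def addTaskParameters : Program :=
  seq (load 10 0 1) <| seq (load 11 1 1) <| seq (div 12 10 11) <| seq (add 4 4 12) <|
    -- Register `15` is never written and holds `0`, so this addition is a copy.
    seq (add 5 5 10) <| seq (ifLe 12 6 skip (add 6 12 15)) <| 
    seq (mul 13 10 12) (add 7 7 13)

def addTask : Program :=
  seq addTaskParameters (loop 2 0 addPairTerm)

/-- Compares the collected sums, with the parameters of the task under test in real registers `1`
(deadline), `2` (execution time) and `3` (period). -/
def evalTest : Program :=
  seq (div 8 2 3) <| seq (add 8 4 8) <| seq (div 9 5 1) <|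
  seq (add 10 4 9) <| seq (div 10 10 0) <| seq (one 11) <| seq (sub 10 11 10) <|
  seq (div 12 7 1) <| seq (add 13 11 11) <| seq (div 12 12 13) <|
  seq (mul 13 0 0) <| seq (div 12 12 13) <| seq (add 10 10 12) <|
  ifLe 8 0 (ifLe 9 0 (ifLe 6 10 (one 0) (zero 0)) (zero 0)) (zero 0)

def loadTask : Program :=
  -- Index register `0` is both the number of higher-priority tasks and, counting from zero, the
  -- position of the task under test. Register `6` starts the running maximum at `C k / D k`.
  seq (load 1 2 0) <| seq (load 2 0 0) <| seq (load 3 1 0) (div 6 2 1)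

def testProgram : Program :=
  seq loadTask <| seq (loop 1 0 addTask) evalTest

theorem addPairTerm_run (s : State) :
    (addPairTerm.run s).1.mem = s.mem ∧ (addPairTerm.run s).1.idx = s.idx ∧
      (∀ r < 20, r ≠ 7 → (addPairTerm.run s).1.reg r = s.reg r) ∧
      (addPairTerm.run s).1.reg 7 = s.reg 7 +
        s.reg 10 * s.mem 0 (s.idx 2) / max (s.reg 11) (s.mem 1 (s.idx 2)) ∧
      (addPairTerm.run s).2 ≤ 6 := by
  by_cases h : s.reg 11 ≤ s.mem 1 (s.idx 2)
  · refine ⟨?_, ?_, fun r h1 h2 => ?_, ?_, ?_⟩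
    all_goals simp [addPairTerm, run, State.setReg, h]
    grind [Function.update_apply]
  · refine ⟨?_, ?_, fun r h1 h2 => ?_, ?_, ?_⟩
    all_goals simp [addPairTerm, run, State.setReg, h, max_eq_left (not_le.1 h).le]
    grind [Function.update_apply]

theorem loop_addPairTerm_run (s : State) :
    ((loop 2 0 addPairTerm).run s).1.mem = s.mem ∧
      (∀ i, i ≠ 2 → ((loop 2 0 addPairTerm).run s).1.idx i = s.idx i) ∧
      (∀ r < 20, r ≠ 7 → ((loop 2 0 addPairTerm).run s).1.reg r = s.reg r) ∧
      ((loop 2 0 addPairTerm).run s).1.reg 7 = s.reg 7 +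
        ∑ b ∈ Finset.range (s.idx 0), s.reg 10 * s.mem 0 b / max (s.reg 11) (s.mem 1 b) ∧
      ((loop 2 0 addPairTerm).run s).2 ≤ 1 + s.idx 0 * 7 := by
  have h := run_loop_of_invariant 2 0 addPairTerm s 6
    (fun m s' => s'.mem = s.mem ∧ (∀ i, i ≠ 2 → s'.idx i = s.idx i) ∧
      (∀ r < 20, r ≠ 7 → s'.reg r = s.reg r) ∧
      s'.reg 7 = s.reg 7 +
        ∑ b ∈ Finset.range m, s.reg 10 * s.mem 0 b / max (s.reg 11) (s.mem 1 b))
    ⟨rfl, fun _ _ => rfl, fun _ _ _ => rfl, by simp⟩ ?_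
  · exact ⟨h.1.1, h.1.2.1, h.1.2.2.1, h.1.2.2.2, h.2⟩
  · rintro m - s' ⟨h1, h2, h3, h4⟩
    obtain ⟨g1, g2, g3, g4, g5⟩ := addPairTerm_run (s'.setIdx 2 m)
    refine ⟨⟨g1.trans h1, fun i hi => ?_, fun r hr hr' => (g3 r hr hr').trans (h3 r hr hr'), ?_⟩,
      g5⟩
    · rw [g2]
      simpa [State.setIdx, hi] using h2 i hi
    · rw [g4, Finset.sum_range_succ, ← add_assoc]
      simp [State.setIdx, h1, h4, h3 10, h3 11]

theorem addTaskParameters_run (s : State) (h15 : s.reg 15 = 0) :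
    (addTaskParameters.run s).1.mem = s.mem ∧ (addTaskParameters.run s).1.idx = s.idx ∧
      (∀ r, r < 4 ∨ r = 15 → (addTaskParameters.run s).1.reg r = s.reg r) ∧
      (addTaskParameters.run s).1.reg 4 =
        s.reg 4 + s.mem 0 (s.idx 1) / s.mem 1 (s.idx 1) ∧
      (addTaskParameters.run s).1.reg 5 = s.reg 5 + s.mem 0 (s.idx 1) ∧
      (addTaskParameters.run s).1.reg 6 =
        max (s.reg 6) (s.mem 0 (s.idx 1) / s.mem 1 (s.idx 1)) ∧
      (addTaskParameters.run s).1.reg 7 = s.reg 7 +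
        s.mem 0 (s.idx 1) * (s.mem 0 (s.idx 1) / s.mem 1 (s.idx 1)) ∧
      (addTaskParameters.run s).1.reg 10 = s.mem 0 (s.idx 1) ∧
      (addTaskParameters.run s).1.reg 11 = s.mem 1 (s.idx 1) ∧
      (addTaskParameters.run s).2 ≤ 9 := by
  by_cases h : s.mem 0 (s.idx 1) / s.mem 1 (s.idx 1) ≤ s.reg 6
  · refine ⟨?_, ?_, fun r h1 => ?_, ?_, ?_, ?_, ?_, ?_, ?_, ?_⟩
    all_goals simp [addTaskParameters, run, State.setReg, h]
    grind [Function.update_apply]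
  · refine ⟨?_, ?_, fun r h1 => ?_, ?_, ?_, ?_, ?_, ?_, ?_, ?_⟩
    all_goals simp [addTaskParameters, run, State.setReg, h, max_eq_right (not_le.1 h).le, h15]
    grind [Function.update_apply]

theorem addTask_run (s : State) (h15 : s.reg 15 = 0) :
    (addTask.run s).1.mem = s.mem ∧ (∀ i, i ≠ 2 → (addTask.run s).1.idx i = s.idx i) ∧
      (∀ r, r < 4 ∨ r = 15 → (addTask.run s).1.reg r = s.reg r) ∧
      (addTask.run s).1.reg 4 = s.reg 4 + s.mem 0 (s.idx 1) / s.mem 1 (s.idx 1) ∧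
      (addTask.run s).1.reg 5 = s.reg 5 + s.mem 0 (s.idx 1) ∧
      (addTask.run s).1.reg 6 = max (s.reg 6) (s.mem 0 (s.idx 1) / s.mem 1 (s.idx 1)) ∧
      (addTask.run s).1.reg 7 = s.reg 7 +
        (s.mem 0 (s.idx 1) * (s.mem 0 (s.idx 1) / s.mem 1 (s.idx 1)) +
        ∑ b ∈ Finset.range (s.idx 0),
          s.mem 0 (s.idx 1) * s.mem 0 b / max (s.mem 1 (s.idx 1)) (s.mem 1 b)) ∧
      (addTask.run s).2 ≤ 10 + s.idx 0 * 7 := by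
  obtain ⟨a1, a2, a3, a4, a5, a6, a7, a8, a9, a10⟩ := addTaskParameters_run s h15
  obtain ⟨g1, g2, g3, g4, g5⟩ := loop_addPairTerm_run (addTaskParameters.run s).1
  simp only [addTask, run.eq_13]
  refine ⟨g1.trans a1, fun i hi => (g2 i hi).trans (congrFun a2 i), fun r hr => ?_, ?_, ?_, ?_, ?_,
    ?_⟩
  · rw [g3 r (by omega) (by omega), a3 r hr]
  · rw [g3 4 (by omega) (by omega), a4]
  · rw [g3 5 (by omega) (by omega), a5]
  · rw [g3 6 (by omega) (by omega), a6]
  · rw [g4, a1, a2, a7, a8, a9, add_assoc]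
  · rw [a2] at g5
    omega

theorem loop_addTask_run (s : State) (h15 : s.reg 15 = 0) :
    (∀ r < 4, ((loop 1 0 addTask).run s).1.reg r = s.reg r) ∧
      ((loop 1 0 addTask).run s).1.reg 4 =
        s.reg 4 + ∑ a ∈ Finset.range (s.idx 0), s.mem 0 a / s.mem 1 a ∧
      ((loop 1 0 addTask).run s).1.reg 5 =
        s.reg 5 + ∑ a ∈ Finset.range (s.idx 0), s.mem 0 a ∧
      (∀ x, ((loop 1 0 addTask).run s).1.reg 6 ≤ x ↔
        s.reg 6 ≤ x ∧ ∀ a < s.idx 0, s.mem 0 a / s.mem 1 a ≤ x) ∧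
      ((loop 1 0 addTask).run s).1.reg 7 =
        s.reg 7 + ∑ a ∈ Finset.range (s.idx 0), (s.mem 0 a * (s.mem 0 a / s.mem 1 a) +
          ∑ b ∈ Finset.range (s.idx 0), s.mem 0 a * s.mem 0 b / max (s.mem 1 a) (s.mem 1 b)) ∧
      ((loop 1 0 addTask).run s).2 ≤ 1 + s.idx 0 * (10 + s.idx 0 * 7 + 1) := by
  have h := run_loop_of_invariant 1 0 addTask s (10 + s.idx 0 * 7)
    (fun m s' => s'.mem = s.mem ∧ s'.idx 0 = s.idx 0 ∧
      (∀ r, r < 4 ∨ r = 15 → s'.reg r = s.reg r) ∧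
      s'.reg 4 = s.reg 4 + ∑ a ∈ Finset.range m, s.mem 0 a / s.mem 1 a ∧
      s'.reg 5 = s.reg 5 + ∑ a ∈ Finset.range m, s.mem 0 a ∧
      -- The maximum is described by its upper bounds, the form that `deltaMax_le_iff` supplies for
      -- `deltaMax`.
      (∀ x, s'.reg 6 ≤ x ↔ s.reg 6 ≤ x ∧ ∀ a < m, s.mem 0 a / s.mem 1 a ≤ x) ∧
      s'.reg 7 = s.reg 7 + ∑ a ∈ Finset.range m, (s.mem 0 a * (s.mem 0 a / s.mem 1 a) +
          ∑ b ∈ Finset.range (s.idx 0), s.mem 0 a * s.mem 0 b / max (s.mem 1 a) (s.mem 1 b)))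
    ⟨rfl, rfl, fun _ _ => rfl, by simp, by simp, by simp, by simp⟩ ?_
  · obtain ⟨⟨-, -, h3, h4, h5, h6, h7⟩, h8⟩ := h
    exact ⟨fun r hr => h3 r (Or.inl hr), h4, h5, h6, h7, h8⟩
  · rintro m - s' ⟨h1, h2, h3, h4, h5, h6, h7⟩
    obtain ⟨g1, g2, g3, g4, g5, g6, g7, g8⟩ := addTask_run (s'.setIdx 1 m)
      ((h3 15 (Or.inr rfl)).trans h15)
    have e0 : (s'.setIdx 1 m).idx 0 = s.idx 0 := h2
    have e1 : (s'.setIdx 1 m).idx 1 = m := by simp [State.setIdx]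
    have em : (s'.setIdx 1 m).mem = s.mem := h1
    have er : (s'.setIdx 1 m).reg = s'.reg := rfl
    simp only [e0, e1, em, er] at g1 g3 g4 g5 g6 g7 g8
    refine ⟨⟨g1, (g2 0 (by omega)).trans e0, fun r hr => (g3 r hr).trans (h3 r hr), ?_, ?_,
      fun x => ?_, ?_⟩, g8⟩
    · rw [g4, h4, Finset.sum_range_succ, add_assoc]
    · rw [g5, h5, Finset.sum_range_succ, add_assoc]
    · rw [g6, max_le_iff, h6, and_assoc]
      simp only [Nat.lt_succ_iff_lt_or_eq, or_imp, forall_and, forall_eq]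
    · rw [g7, h7, Finset.sum_range_succ, add_assoc]

theorem loadTask_run (s : State) :
    (loadTask.run s).1.mem = s.mem ∧ (loadTask.run s).1.idx = s.idx ∧
      (loadTask.run s).1.reg = Function.update (Function.update (Function.update
        (Function.update s.reg 1 (s.mem 2 (s.idx 0))) 2 (s.mem 0 (s.idx 0))) 3 (s.mem 1 (s.idx 0)))
        6 (s.mem 0 (s.idx 0) / s.mem 2 (s.idx 0)) ∧
      (loadTask.run s).2 = 4 := by
  refine ⟨?_, ?_, ?_, ?_⟩ <;> simp [loadTask, run, State.setReg]

theorem evalTest_run (s : State) :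
    (s.reg 4 + s.reg 2 / s.reg 3 ≤ s.reg 0 ∧ s.reg 5 / s.reg 1 ≤ s.reg 0 ∧
        s.reg 6 ≤ 1 - (s.reg 4 + s.reg 5 / s.reg 1) / s.reg 0 +
          s.reg 7 / s.reg 1 / 2 / (s.reg 0 * s.reg 0) → (evalTest.run s).1.reg 0 = 1) ∧
      (¬ (s.reg 4 + s.reg 2 / s.reg 3 ≤ s.reg 0 ∧ s.reg 5 / s.reg 1 ≤ s.reg 0 ∧
        s.reg 6 ≤ 1 - (s.reg 4 + s.reg 5 / s.reg 1) / s.reg 0 +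
          s.reg 7 / s.reg 1 / 2 / (s.reg 0 * s.reg 0)) → (evalTest.run s).1.reg 0 = 0) ∧
      (evalTest.run s).2 ≤ 20 := by
  have e : (1 : ℝ) + 1 = 2 := one_add_one_eq_two
  refine ⟨fun h => ?_, fun h => ?_, ?_⟩
  · simp [evalTest, run, State.setReg, e, h]
  · simp [evalTest, run, State.setReg, e]
    split_ifs <;> simp_all
  · simp [evalTest, run, State.setReg]
    split_ifs <;> simp

theorem sum_Iio_eq_sum_range {n : ℕ} (k : Fin n) (f : ℕ → ℝ) :
    ∑ a ∈ Finset.range k.val, f a = ∑ i ∈ Finset.Iio k, f i.val := by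
  rw [← Finset.sum_image (s := Finset.Iio k) (f := f) (g := fun i : Fin n => i.val)
    (fun a _ b _ h => Fin.ext h)]
  refine Finset.sum_congr ?_ fun _ _ => rfl
  ext a
  simp only [Finset.mem_range, Finset.mem_image, Finset.mem_Iio]
  exact ⟨fun h => ⟨⟨a, h.trans k.isLt⟩, Fin.lt_def.2 h, rfl⟩,
    by rintro ⟨i, hi, rfl⟩; exact hi⟩

theorem testProgram_steps (s : State) (h15 : s.reg 15 = 0) :
    (testProgram.run s).2 ≤ 40 * (s.idx 0 + 1) ^ 2 := by
  obtain ⟨-, a2, a3, a4⟩ := loadTask_run s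
  obtain ⟨-, -, -, -, -, b6⟩ := loop_addTask_run (loadTask.run s).1
    (by rw [a3]; simp [Function.update_of_ne, h15])
  have c2 := (evalTest_run ((loop 1 0 addTask).run (loadTask.run s).1).1).2.2
  rw [a2] at b6
  have e : (testProgram.run s).2 = (loadTask.run s).2 +
    (((loop 1 0 addTask).run (loadTask.run s).1).2 +
      (evalTest.run ((loop 1 0 addTask).run (loadTask.run s).1).1).2) := rfl
  rw [e, a4]
  refine (Nat.add_le_add_left (Nat.add_le_add b6 c2) 4).trans ?_
  generalize s.idx 0 = k
  nlinarith

theorem testProgram_decides : testProgram.DecidesTestInPolynomialTime := by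
  refine ⟨40, 2, fun n τ M k _ => ?_⟩
  have hsteps := testProgram_steps (inputState τ M k) (by simp [inputState])
  have hC : ∀ i : Fin n, (inputState τ M k).mem 0 i.val = τ.C i := fun i => by simp [inputState]
  have hT : ∀ i : Fin n, (inputState τ M k).mem 1 i.val = τ.T i := fun i => by simp [inputState]
  have hD : ∀ i : Fin n, (inputState τ M k).mem 2 i.val = τ.D i := fun i => by simp [inputState]
  have hk : (inputState τ M k).idx 0 = k.val := rfl
  have z : ∀ r, r ≠ 0 → (inputState τ M k).reg r = 0 := fun r hr => by simp [inputState, hr]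
  have zM : (inputState τ M k).reg 0 = M := by simp [inputState]
  rw [hk] at hsteps
  suffices h : (τ.PassesTest M k → (testProgram.run (inputState τ M k)).1.reg 0 = 1) ∧
      (¬ τ.PassesTest M k → (testProgram.run (inputState τ M k)).1.reg 0 = 0) from
    ⟨h.1, h.2, hsteps⟩
  generalize inputState τ M k = s at *
  obtain ⟨a1, a2, a3, -⟩ := loadTask_run s
  have e : (testProgram.run s).1 =
    (evalTest.run ((loop 1 0 addTask).run (loadTask.run s).1).1).1 := rfl
  rw [e]
  generalize (loadTask.run s).1 = s₁ at *
  obtain ⟨b1, b2, b3, b4, b5, -⟩ := loop_addTask_run s₁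
    (by rw [a3]; simp [Function.update_of_ne, z])
  generalize ((loop 1 0 addTask).run s₁).1 = s₂ at *
  obtain ⟨c0, c1, -⟩ := evalTest_run s₂
  have r0 : s₂.reg 0 = M := by rw [b1 0 (by omega), a3]; simp [zM]
  have r1 : s₂.reg 1 = τ.D k := by rw [b1 1 (by omega), a3]; simp [hk, hD]
  have r2 : s₂.reg 2 = τ.C k := by rw [b1 2 (by omega), a3]; simp [hk, hC]
  have r3 : s₂.reg 3 = τ.T k := by rw [b1 3 (by omega), a3]; simp [hk, hT]
  have q4 : s₁.reg 4 = 0 := by rw [a3]; simp [z]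
  have q5 : s₁.reg 5 = 0 := by rw [a3]; simp [z]
  have q6 : s₁.reg 6 = τ.C k / τ.D k := by rw [a3]; simp [hk, hC, hD]
  have q7 : s₁.reg 7 = 0 := by rw [a3]; simp [z]
  rw [a1, a2, hk, sum_Iio_eq_sum_range, q4, zero_add] at b2
  rw [a1, a2, hk, sum_Iio_eq_sum_range, q5, zero_add] at b3
  rw [a1, a2, hk, sum_Iio_eq_sum_range, q7, zero_add] at b5
  simp only [sum_Iio_eq_sum_range, hC, hT] at b2 b3 b5
  have e6 : ∀ x, s₂.reg 6 ≤ x ↔ τ.deltaMax k ≤ x := by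
    intro x
    rw [b4, τ.deltaMax_le_iff, q6, a1, a2, hk]
    refine and_congr_right fun _ => ⟨fun h i hi => ?_, fun h a ha => ?_⟩
    · have := h i.val hi
      rwa [hC, hT] at this
    · have := h ⟨a, ha.trans k.isLt⟩ ha
      rwa [TaskSystem.U, ← hC, ← hT] at this
  have e7 : s₂.reg 7 = τ.pairSum k := by
    rw [b5, Finset.sum_add_distrib, add_comm]
    rfl
  have hiff := τ.passesTest_iff M k
  rw [e6, e7, r0, r1, r2, r3, b2, b3] at c0 c1
  exact ⟨fun h => c0 (hiff.1 h), fun h => c1 fun h' => h (hiff.2 h')⟩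

end Program

/-! ### Scaling of execution times and speeds -/

namespace Schedule

variable {n M : ℕ} {τ τ' : TaskSystem n} {A : Arrivals τ} {A' : Arrivals τ'} {a : ℝ}

/-- Demand and service both acquire the factor `a`, which cancels; all other scheduling notions
depend on speed and execution times only through completion. -/
theorem finished_scale (σ : Schedule n M) (ha : 0 < a)
    (hexec : ∀ i j, A'.exec i j = a * A.exec i j) (s : ℝ) (J : Job n) (t : ℝ) :
    σ.Finished (a * s) A' J t ↔ σ.Finished s A J t := by
  rw [Finished, Finished, hexec, service, service, mul_assoc, mul_le_mul_iff_right₀ ha]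

theorem ready_scale (σ : Schedule n M) (ha : 0 < a) (hrel : A'.release = A.release)
    (hexec : ∀ i j, A'.exec i j = a * A.exec i j) (s : ℝ) (J : Job n) (t : ℝ) :
    σ.Ready (a * s) A' J t ↔ σ.Ready s A J t := by
  simp only [Ready, finished_scale σ ha hexec, hrel]

theorem isValid_scale (σ : Schedule n M) (ha : 0 < a) (hrel : A'.release = A.release)
    (hexec : ∀ i j, A'.exec i j = a * A.exec i j) (s : ℝ) :
    σ.IsValid (a * s) A' ↔ σ.IsValid s A := by
  simp only [IsValid, ready_scale σ ha hrel hexec]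

theorem isGlobalFixedPriority_scale (σ : Schedule n M) (ha : 0 < a)
    (hrel : A'.release = A.release) (hexec : ∀ i j, A'.exec i j = a * A.exec i j) (s : ℝ) :
    σ.IsGlobalFixedPriority (a * s) A' ↔ σ.IsGlobalFixedPriority s A := by
  simp only [IsGlobalFixedPriority, ready_scale σ ha hrel hexec, isValid_scale σ ha hrel hexec]

theorem taskMeetsDeadlines_scale (σ : Schedule n M) (ha : 0 < a)
    (hrel : A'.release = A.release) (hexec : ∀ i j, A'.exec i j = a * A.exec i j)
    (hD : τ'.D = τ.D) (s : ℝ) (k : Fin n) :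
    σ.TaskMeetsDeadlines (a * s) A' k ↔ σ.TaskMeetsDeadlines s A k := by
  simp only [TaskMeetsDeadlines, finished_scale σ ha hexec, hrel, hD]

end Schedule

namespace TaskSystem

variable {n : ℕ}

/-- The task system with all execution times multiplied by `a`. -/
def scaleExec (τ : TaskSystem n) (a : ℝ) (ha : 0 < a) : TaskSystem n where
  C i := a * τ.C i
  T := τ.T
  D := τ.D
  C_pos i := mul_pos ha (τ.C_pos i)
  T_pos := τ.T_pos
  D_pos := τ.D_pos
  D_le_T := τ.D_le_T

theorem Schedulable.of_scaleExec {τ : TaskSystem n} {M : ℕ} {a s : ℝ} (ha : 0 < a)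
    (h : (τ.scaleExec a ha).Schedulable M (a * s)) : τ.Schedulable M s := by
  intro k A σ hσ
  let A' : Arrivals (τ.scaleExec a ha) :=
    { release := A.release
      exec := fun i j => a * A.exec i j
      release_nonneg := A.release_nonneg
      release_sep := A.release_sep
      exec_nonneg := fun i j => mul_nonneg ha.le (A.exec_nonneg i j)
      exec_le := fun i j => mul_le_mul_of_nonneg_left (A.exec_le i j) ha.le }
  have hrel : A'.release = A.release := rfl
  have hexec : ∀ i j, A'.exec i j = a * A.exec i j := fun _ _ => rfl
  exact (σ.taskMeetsDeadlines_scale ha hrel hexec rfl s k).1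
    (h k A' σ ((σ.isGlobalFixedPriority_scale ha hrel hexec s).2 hσ))

theorem Feasible.scaleExec {τ : TaskSystem n} {M : ℕ} {a s : ℝ} (ha : 0 < a)
    (h : τ.Feasible M s) : (τ.scaleExec a ha).Feasible M (a * s) := by
  intro A'
  let A : Arrivals τ :=
    { release := A'.release
      exec := fun i j => a⁻¹ * A'.exec i j
      release_nonneg := A'.release_nonneg
      release_sep := A'.release_sep
      exec_nonneg := fun i j => mul_nonneg (inv_pos.2 ha).le (A'.exec_nonneg i j)
      exec_le := fun i j => (inv_mul_le_iff₀ ha).2 (A'.exec_le i j) }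
  have hrel : A'.release = A.release := rfl
  have hexec : ∀ i j, A'.exec i j = a * A.exec i j := fun i j =>
    (mul_inv_cancel_left₀ ha.ne' _).symm
  obtain ⟨σ, hσ, hd⟩ := h A
  exact ⟨σ, (σ.isValid_scale ha hrel hexec s).2 hσ,
    fun k => (σ.taskMeetsDeadlines_scale ha hrel hexec rfl s k).2 (hd k)⟩

end TaskSystem

/-! ### Execution in time intervals -/

namespace Schedule

variable {n M : ℕ} (σ : Schedule n M)

/-- The time in `[a, b)` during which job `J` is executed. -/
noncomputable def execIn (J : Job n) (a b : ℝ) : ℝ :=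
  volume.real {x | x ∈ Set.Ico a b ∧ σ.Runs J x}

theorem measurableSet_runs (J : Job n) : MeasurableSet {x | σ.Runs J x} := by
  simp only [Runs, Set.ofPred_exists]
  exact MeasurableSet.iUnion fun p => σ.measurable p J

theorem volume_Ico_inter_ne_top {a b : ℝ} (p : ℝ → Prop) :
    volume {x | x ∈ Set.Ico a b ∧ p x} ≠ ⊤ :=
  ((measure_mono fun _ hx => hx.1).trans_lt (measure_Ico_lt_top (a := a) (b := b))).ne

theorem execIn_nonneg (J : Job n) (a b : ℝ) : 0 ≤ σ.execIn J a b := measureReal_nonneg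

theorem execIn_le (J : Job n) {a b : ℝ} (hab : a ≤ b) : σ.execIn J a b ≤ b - a := by
  rw [← Real.volume_real_Ico_of_le hab]
  exact measureReal_mono (fun _ hx => hx.1) (measure_Ico_lt_top (a := a) (b := b)).ne

theorem execIn_add (J : Job n) {a b c : ℝ} (hab : a ≤ b) (hbc : b ≤ c) :
    σ.execIn J a b + σ.execIn J b c = σ.execIn J a c := by
  rw [execIn, execIn, ← measureReal_union _ _ (volume_Ico_inter_ne_top _)
    (volume_Ico_inter_ne_top _)]
  · rw [execIn]
    congr 1
    ext x
    simp only [Set.mem_union, Set.mem_ofPred_eq, Set.mem_Ico]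
    grind
  · rw [Set.disjoint_left]
    rintro x ⟨hx, -⟩ ⟨hx', -⟩
    exact hx.2.not_ge hx'.1
  · exact measurableSet_Ico.inter (σ.measurableSet_runs J)

theorem execIn_eq_zero (J : Job n) {a b : ℝ} (h : ∀ x, a ≤ x → x < b → ¬ σ.Runs J x) :
    σ.execIn J a b = 0 := by
  rw [execIn, show {x | x ∈ Set.Ico a b ∧ σ.Runs J x} = ∅ from
    Set.eq_empty_iff_forall_notMem.2 fun x hx => h x hx.1.1 hx.1.2 hx.2]
  exact measureReal_empty

theorem execIn_le_execIn (J : Job n) {a b c d : ℝ} (hca : c ≤ a) (hbd : b ≤ d) :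
    σ.execIn J a b ≤ σ.execIn J c d :=
  measureReal_mono (fun _ hx => ⟨⟨hca.trans hx.1.1, hx.1.2.trans_le hbd⟩, hx.2⟩)
    (volume_Ico_inter_ne_top _)

theorem service_eq (s : ℝ) (J : Job n) (t : ℝ) : σ.service s J t = s * σ.execIn J 0 t := rfl

theorem Finished.mono {σ : Schedule n M} {s : ℝ} (hs : 0 ≤ s) {τ : TaskSystem n} {A : Arrivals τ}
    {J : Job n} {t t' : ℝ} (h : σ.Finished s A J t) (htt : t ≤ t') : σ.Finished s A J t' := by
  rw [Finished, service_eq] at *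
  exact h.trans (mul_le_mul_of_nonneg_left (σ.execIn_le_execIn J le_rfl htt) hs)

/-- Execution time is 1-Lipschitz in the right endpoint. Continuity yields the maximizing window
start and the intermediate value argument in `IsValid.execIn_le_exec`. -/
theorem continuousOn_execIn (J : Job n) (a : ℝ) :
    ContinuousOn (σ.execIn J a) (Set.Ici a) := by
  refine (LipschitzOnWith.of_le_add fun x hx y hy => ?_).continuousOn
  rcases le_total x y with h | h
  · have := σ.execIn_le_execIn J (le_refl a) h
    have := dist_nonneg (x := x) (y := y)
    linarith
  · rw [← σ.execIn_add J hy h, Real.dist_eq, abs_of_nonneg (sub_nonneg.2 h)]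
    linarith [σ.execIn_le J h]

/-- On one processor the execution sets of distinct jobs are disjoint, so each processor contributes
at most the length of the interval. -/
theorem sum_execIn_le (S : Finset (Job n)) {a b : ℝ} (hab : a ≤ b) :
    ∑ J ∈ S, σ.execIn J a b ≤ M * (b - a) := by
  have h1 : ∀ J ∈ S, σ.execIn J a b ≤
      ∑ p, volume.real {x | x ∈ Set.Ico a b ∧ σ.proc p x = some J} := by
    intro J _
    refine le_trans (measureReal_mono ?_ ?_) (measureReal_biUnion_finset_le Finset.univ
      (fun p => {x | x ∈ Set.Ico a b ∧ σ.proc p x = some J}))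
    · rintro x ⟨hx, p, hp⟩
      exact Set.mem_biUnion (Finset.mem_coe.2 (Finset.mem_univ p)) ⟨hx, hp⟩
    · exact ((measure_mono (Set.iUnion₂_subset fun p _ x hx => hx.1)).trans_lt
        (measure_Ico_lt_top (a := a) (b := b))).ne
  refine (Finset.sum_le_sum h1).trans ?_
  rw [Finset.sum_comm]
  have h2 : ∀ p : Fin M,
      ∑ J ∈ S, volume.real {x | x ∈ Set.Ico a b ∧ σ.proc p x = some J} ≤ b - a := by
    intro p
    rw [← measureReal_biUnion_finset ?_ ?_ ?_, ← Real.volume_real_Ico_of_le hab]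
    · exact measureReal_mono (Set.iUnion₂_subset fun J _ x hx => hx.1)
        (measure_Ico_lt_top (a := a) (b := b)).ne
    · intro J _ J' _ hJ
      rw [Function.onFun, Set.disjoint_left]
      rintro x ⟨-, hx⟩ ⟨-, hx'⟩
      exact hJ (Option.some_injective _ (hx.symm.trans hx'))
    · exact fun J _ => measurableSet_Ico.inter (σ.measurable p J)
    · exact fun J _ => volume_Ico_inter_ne_top _
  exact (Finset.sum_le_sum fun p _ => h2 p).trans_eq 
    (by rw [Finset.sum_const, Finset.card_univ, Fintype.card_fin, nsmul_eq_mul])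

/-- If all processors execute jobs of `S` whenever `J` is not executed, then the jobs of `S`
receive the capacity of all processors during the time in which `J` is not executed. -/
theorem le_sum_execIn (S : Finset (Job n)) (J : Job n) {a b : ℝ} (hab : a ≤ b)
    (hproc : ∀ x ∈ Set.Ico a b, ∀ p q J, σ.proc p x = some J → σ.proc q x = some J → p = q)
    (hbusy : ∀ x ∈ Set.Ico a b, ¬ σ.Runs J x → ∀ p, ∃ J' ∈ S, σ.proc p x = some J') :
    M * (b - a - σ.execIn J a b) ≤ ∑ J' ∈ S, σ.execIn J' a b := by
  -- No job runs on two processors at once, so its execution sets on the different processors are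
  -- disjoint.
  have h1 : ∀ J' ∈ S, ∑ p, volume.real {x | x ∈ Set.Ico a b ∧ σ.proc p x = some J'} ≤
      σ.execIn J' a b := by
    intro J' _
    rw [← measureReal_biUnion_finset ?_ ?_ ?_]
    · exact measureReal_mono (Set.iUnion₂_subset fun p _ x hx => ⟨hx.1, p, hx.2⟩)
        (volume_Ico_inter_ne_top _)
    · intro p _ q _ hpq
      rw [Function.onFun, Set.disjoint_left]
      rintro x ⟨hx0, hx⟩ ⟨-, hx'⟩
      exact hpq (hproc x hx0 p q J' hx hx')
    · exact fun p _ => measurableSet_Ico.inter (σ.measurable p J')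
    · exact fun p _ => volume_Ico_inter_ne_top _
  refine le_trans ?_ (Finset.sum_le_sum h1)
  rw [Finset.sum_comm]
  have hE : b - a - σ.execIn J a b =
      volume.real (Set.Ico a b \ {x | x ∈ Set.Ico a b ∧ σ.Runs J x}) := by
    rw [measureReal_sdiff (h₁ := (measure_Ico_lt_top (a := a) (b := b)).ne)
      (fun _ (hx : _ ∈ {x | x ∈ Set.Ico a b ∧ σ.Runs J x}) => hx.1)
      (measurableSet_Ico.inter (σ.measurableSet_runs J)), Real.volume_real_Ico_of_le hab]
    rfl
  have h2 : ∀ p : Fin M, b - a - σ.execIn J a b ≤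
      ∑ J' ∈ S, volume.real {x | x ∈ Set.Ico a b ∧ σ.proc p x = some J'} := by
    intro p
    rw [hE]
    refine le_trans (measureReal_mono ?_ ?_) (measureReal_biUnion_finset_le S
      (fun J' => {x | x ∈ Set.Ico a b ∧ σ.proc p x = some J'}))
    · rintro x ⟨hx, hx'⟩
      obtain ⟨J', hJ', hp⟩ := hbusy x hx (fun h => hx' ⟨hx, h⟩) p
      exact Set.mem_biUnion (Finset.mem_coe.2 hJ') ⟨hx, hp⟩
    · exact ((measure_mono (Set.iUnion₂_subset fun p _ x hx => hx.1)).trans_lt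
        (measure_Ico_lt_top (a := a) (b := b))).ne
  exact le_of_eq_of_le
    (by rw [Finset.sum_const, Finset.card_univ, Fintype.card_fin, nsmul_eq_mul])
    (Finset.sum_le_sum fun p _ => h2 p)

end Schedule

/-! ### Necessary conditions for feasibility -/

namespace TaskSystem

variable {n : ℕ} (τ : TaskSystem n)

/-- All tasks release jobs strictly periodically from time `0` on, and all jobs need their
worst-case execution times. -/
def synchronousArrivals : Arrivals τ where
  release i j := j * τ.T i
  exec i _ := τ.C i
  release_nonneg i := by simp
  release_sep i j := by push_cast; linarith
  exec_nonneg i _ := (τ.C_pos i).le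
  exec_le i _ := le_rfl

variable {τ}

theorem Feasible.C_le {M : ℕ} {s : ℝ} (hs : 0 ≤ s) (h : τ.Feasible M s) (i : Fin n) :
    τ.C i ≤ s * τ.D i := by
  obtain ⟨σ, -, hd⟩ := h τ.synchronousArrivals
  have h1 := hd i 0
  rw [Schedule.Finished, σ.service_eq] at h1
  refine h1.trans (mul_le_mul_of_nonneg_left ?_ hs)
  refine (σ.execIn_le _ ?_).trans ?_
  · simp [synchronousArrivals, (τ.D_pos i).le]
  · simp [synchronousArrivals]

theorem sum_exec_le_of_finished {M : ℕ} {s : ℝ} (hs : 0 ≤ s) {A : Arrivals τ} (σ : Schedule n M)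
    (S : Finset (Job n)) {t : ℝ} (ht : 0 ≤ t) (h : ∀ J ∈ S, σ.Finished s A J t) :
    ∑ J ∈ S, A.exec J.1 J.2 ≤ s * (M * t) := by
  refine (Finset.sum_le_sum h).trans ?_
  simp only [σ.service_eq, ← Finset.mul_sum]
  have := σ.sum_execIn_le S ht
  rw [sub_zero] at this
  exact mul_le_mul_of_nonneg_left this hs

/-- With synchronous release, deadline monotonicity makes the first job of every task before `k` due
by `D k`. -/
theorem Feasible.sum_C_le {M : ℕ} {s : ℝ} (hs : 0 ≤ s) (h : τ.Feasible M s)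
    (hdm : τ.DeadlineMonotonic) (k : Fin n) :
    ∑ i ∈ Finset.Iio k, τ.C i ≤ s * (M * τ.D k) := by
  obtain ⟨σ, -, hd⟩ := h τ.synchronousArrivals
  have h1 := sum_exec_le_of_finished hs (A := τ.synchronousArrivals) σ (Finset.Iio k ×ˢ {0})
    (τ.D_pos k).le ?_
  · rw [Finset.sum_product] at h1
    simpa [synchronousArrivals] using h1
  · rintro ⟨i, j⟩ hJ
    simp only [Finset.mem_product, Finset.mem_Iio, Finset.mem_singleton] at hJ
    obtain ⟨hi, rfl⟩ := hJ
    refine (hd i 0).mono hs ?_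
    simpa [synchronousArrivals] using hdm i k hi.le

theorem Feasible.sum_U_le {M : ℕ} {s : ℝ} (hs : 0 ≤ s) (h : τ.Feasible M s) (S : Finset (Fin n)) :
    ∑ i ∈ S, τ.U i ≤ s * M := by
  obtain ⟨σ, -, hd⟩ := h τ.synchronousArrivals
  -- At least `H / T i - 1` periodic jobs of task `i` have their deadlines within `[0, H]`; the loss
  -- is one job per task, independent of `H`.
  have key : ∀ H : ℝ, 0 < H → H * ∑ i ∈ S, τ.U i - ∑ i ∈ S, τ.C i ≤ s * (M * H) := by
    intro H hH
    set r : Finset (Job n) := (S.sigma fun i => Finset.range ⌊H / τ.T i⌋₊).map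
      (Equiv.sigmaEquivProd _ _).toEmbedding with hr
    have hmem : ∀ p : Job n, p ∈ r ↔ p.1 ∈ S ∧ p.2 ∈ Finset.range ⌊H / τ.T p.1⌋₊ := by
      rintro ⟨i, j⟩
      simp [hr]
    have h1 := sum_exec_le_of_finished hs (A := τ.synchronousArrivals) σ r hH.le ?_
    · refine le_trans ?_ h1
      rw [Finset.sum_finset_product r S (fun i => Finset.range ⌊H / τ.T i⌋₊) hmem, Finset.mul_sum, ← Finset.sum_sub_distrib]
      refine Finset.sum_le_sum fun i _ => ?_
      simp only [synchronousArrivals, Finset.sum_const, Finset.card_range, nsmul_eq_mul]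
      have h2 := (Nat.sub_one_lt_floor (H / τ.T i)).le
      calc H * τ.U i - τ.C i = (H / τ.T i - 1) * τ.C i := by rw [U]; ring
        _ ≤ _ := mul_le_mul_of_nonneg_right h2 (τ.C_pos i).le
    · rintro ⟨i, j⟩ hJ
      have hj : j < ⌊H / τ.T i⌋₊ := Finset.mem_range.1 ((hmem _).1 hJ).2
      refine (hd i j).mono hs ?_
      have h2 : ((j + 1 : ℕ) : ℝ) ≤ H / τ.T i :=
        (Nat.le_floor_iff (div_pos hH (τ.T_pos i)).le).1 hj
      rw [le_div_iff₀ (τ.T_pos i)] at h2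
      push_cast at h2
      have := τ.D_le_T i
      simp only [synchronousArrivals]
      linarith
  by_contra! hlt
  have hε := sub_pos.2 hlt
  have hC : 0 ≤ ∑ i ∈ S, τ.C i := Finset.sum_nonneg fun i _ => (τ.C_pos i).le
  -- A horizon at which the surplus demand is the lost `∑ C i` plus one.
  have hH : 0 < (∑ i ∈ S, τ.C i + 1) / (∑ i ∈ S, τ.U i - s * M) := by positivity
  have h1 := key _ hH
  have h2 : (∑ i ∈ S, τ.C i + 1) / (∑ i ∈ S, τ.U i - s * M) * (∑ i ∈ S, τ.U i - s * M) =
    ∑ i ∈ S, τ.C i + 1 := div_mul_cancel₀ _ hε.ne'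
  linarith

end TaskSystem

/-! ### Releases and the work of a task in a window -/

namespace Arrivals

variable {n : ℕ} {τ : TaskSystem n} (A : Arrivals τ)

theorem release_strictMono (i : Fin n) : StrictMono (A.release i) :=
  strictMono_nat_of_lt_succ fun j => by linarith [A.release_sep i j, τ.T_pos i]

theorem mul_T_le_release (i : Fin n) (j : ℕ) : j * τ.T i ≤ A.release i j := by
  induction j with
  | zero => simpa using A.release_nonneg i
  | succ j ih =>
    push_cast
    linarith [A.release_sep i j]

theorem release_nonneg' (i : Fin n) (j : ℕ) : 0 ≤ A.release i j :=
  (mul_nonneg j.cast_nonneg (τ.T_pos i).le).trans (A.mul_T_le_release i j)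

theorem release_add_T_le {i : Fin n} {j j' : ℕ} (h : j < j') :
    A.release i j + τ.T i ≤ A.release i j' :=
  (A.release_sep i j).trans ((A.release_strictMono i).monotone h)

theorem exists_le_release (d : ℝ) : ∃ N, ∀ i, ∀ j ≥ N, d ≤ A.release i j := by
  have h : ∀ i, ∃ N : ℕ, d ≤ A.release i N := fun i => by
    obtain ⟨N, hN⟩ := exists_nat_ge (d / τ.T i)
    exact ⟨N, ((div_le_iff₀ (τ.T_pos i)).1 hN).trans (A.mul_T_le_release i N)⟩
  choose N hN using h
  refine ⟨Finset.univ.sup N, fun i j hj => (hN i).trans ?_⟩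
  exact (A.release_strictMono i).monotone ((Finset.le_sup (Finset.mem_univ i)).trans hj)

end Arrivals

namespace Schedule

variable {n M : ℕ} {σ : Schedule n M} {τ : TaskSystem n} {A : Arrivals τ}

theorem finished_one_iff (J : Job n) (t : ℝ) :
    σ.Finished 1 A J t ↔ A.exec J.1 J.2 ≤ σ.execIn J 0 t := by
  rw [Finished, service_eq, one_mul]

theorem IsValid.ready {s : ℝ} (h : σ.IsValid s A) {J : Job n} {t : ℝ} (ht : 0 ≤ t)
    (hJ : σ.Runs J t) : σ.Ready s A J t := (h t ht).1 J hJ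

theorem IsValid.execIn_eq_zero_of_le_release {s : ℝ} (h : σ.IsValid s A) {J : Job n} {a b : ℝ}
    (ha : 0 ≤ a) (hb : b ≤ A.release J.1 J.2) : σ.execIn J a b = 0 :=
  σ.execIn_eq_zero J fun _ hx hx' hr =>
    (hx'.trans_le hb).not_ge (h.ready (ha.trans hx) hr).1

theorem IsValid.execIn_eq_zero_of_finished {s : ℝ} (hs : 0 ≤ s) (h : σ.IsValid s A) {J : Job n}
    {a b : ℝ} (ha : 0 ≤ a) (hf : σ.Finished s A J a) : σ.execIn J a b = 0 :=
  σ.execIn_eq_zero J fun _ hx _ hr => (h.ready (ha.trans hx) hr).2.1 (hf.mono hs hx)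

/-- Otherwise, by continuity, the job has received exactly its demand at some earlier time; from
then on it is finished and a valid schedule does not run it. -/
theorem IsValid.execIn_le_exec (h : σ.IsValid 1 A) (J : Job n) {t : ℝ} (ht : 0 ≤ t) :
    σ.execIn J 0 t ≤ A.exec J.1 J.2 := by
  by_contra! hlt
  have h0 : σ.execIn J 0 0 = 0 := σ.execIn_eq_zero J fun _ hx hx' => absurd hx' hx.not_gt
  obtain ⟨u, ⟨hu, hut⟩, he⟩ := intermediate_value_Icc ht
    ((σ.continuousOn_execIn J 0).mono Set.Icc_subset_Ici_self)
    ⟨h0.trans_le (A.exec_nonneg J.1 J.2), hlt.le⟩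
  have h1 := h.execIn_eq_zero_of_finished zero_le_one hu (b := t)
    ((finished_one_iff J u).2 he.ge)
  have h2 := σ.execIn_add J hu hut
  linarith

/-- The work of a task in a window `[t₀, d)`, if a job that is carried in has been executed at least
at the rate of its utilization: before the last release in the window the task behaves like a fluid
task, and afterwards at most one job is executed. -/
theorem IsValid.exists_work_bound (h : σ.IsValid 1 A) {i : Fin n}
    (hdl : σ.TaskMeetsDeadlines 1 A i) {t₀ d : ℝ} (ht₀ : 0 ≤ t₀) (hd : t₀ ≤ d)
    (hcarry : ∀ j, A.release i j < t₀ → ¬ σ.Finished 1 A (i, j) t₀ →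
      τ.U i * (t₀ - A.release i j) ≤ σ.execIn (i, j) 0 t₀) (N : ℕ) :
    ∃ y, 0 ≤ y ∧ t₀ + y ≤ d ∧
      ∑ j ∈ Finset.range N, σ.execIn (i, j) t₀ (t₀ + y) ≤ τ.U i * y ∧
      ∑ j ∈ Finset.range N, σ.execIn (i, j) t₀ d ≤ τ.C i + τ.U i * y := by
  have hU := τ.U_pos i
  have hUT : τ.U i * τ.T i = τ.C i := div_mul_cancel₀ _ (τ.T_pos i).ne'
  -- Since `D ≤ T`, a job that meets its deadline is finished by the next release of its task.
  have hprev : ∀ j j', j < j' → ∀ t, A.release i j' ≤ t → σ.Finished 1 A (i, j) t := by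
    intro j j' hj t ht
    refine (hdl j).mono zero_le_one ?_
    linarith [A.release_add_T_le (i := i) hj, τ.D_le_T i]
  have hjob : ∀ j b, t₀ ≤ b → σ.execIn (i, j) t₀ b ≤ τ.C i - σ.execIn (i, j) 0 t₀ := by
    intro j b hb
    have h1 := h.execIn_le_exec (i, j) (ht₀.trans hb)
    rw [← σ.execIn_add _ ht₀ hb] at h1
    linarith [A.exec_le i j]
  have hjob' : ∀ j b, t₀ ≤ b → σ.execIn (i, j) t₀ b ≤ τ.C i := fun j b hb =>
    (hjob j b hb).trans (by linarith [σ.execIn_nonneg (i, j) 0 t₀])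
  have hfluid : ∀ q, t₀ ≤ A.release i q → ∀ b, t₀ ≤ b →
      ∑ j ∈ Finset.range q, σ.execIn (i, j) t₀ b ≤ τ.U i * (A.release i q - t₀) := by
    intro q
    induction q with
    | zero =>
      intro hq b _
      simpa using mul_nonneg hU.le (sub_nonneg.2 hq)
    | succ q ih =>
      intro hq b hb
      rw [Finset.sum_range_succ]
      have hsep := mul_le_mul_of_nonneg_left (A.release_sep i q) hU.le
      rcases le_or_gt t₀ (A.release i q) with hq' | hq'
      · have := ih hq' b hb
        have := hjob' q b hb
        linarith
      -- Job `q` is carried in: by `hcarry` its remaining work is at most `U i` times the rest of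
      -- its period, hence at most `U i` times the distance from `t₀` to the next release.
      · have h0 : ∑ j ∈ Finset.range q, σ.execIn (i, j) t₀ b = 0 :=
          Finset.sum_eq_zero fun j hj => h.execIn_eq_zero_of_finished zero_le_one ht₀
            (hprev j q (Finset.mem_range.1 hj) t₀ hq'.le)
        rw [h0, zero_add]
        by_cases hf : σ.Finished 1 A (i, q) t₀
        · rw [h.execIn_eq_zero_of_finished zero_le_one ht₀ hf]
          exact mul_nonneg hU.le (sub_nonneg.2 hq)
        · have := hcarry q hq' hf
          have := hjob q b hb
          linarith
  have htrunc : ∀ q b, b ≤ A.release i q → ∑ j ∈ Finset.range N, σ.execIn (i, j) t₀ b ≤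
      ∑ j ∈ Finset.range q, σ.execIn (i, j) t₀ b := by
    intro q b hb
    rw [← Finset.sum_filter_add_sum_filter_not (Finset.range N) (· < q)]
    have h0 : ∑ j ∈ Finset.range N with ¬ j < q, σ.execIn (i, j) t₀ b = 0 :=
      Finset.sum_eq_zero fun j hj => h.execIn_eq_zero_of_le_release ht₀
        (hb.trans ((A.release_strictMono i).monotone (not_lt.1 (Finset.mem_filter.1 hj).2)))
    rw [h0, add_zero]
    exact Finset.sum_le_sum_of_subset_of_nonneg
      (fun j hj => Finset.mem_range.2 (Finset.mem_filter.1 hj).2)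
      fun j _ _ => σ.execIn_nonneg _ _ _
  have hzero : ∑ j ∈ Finset.range N, σ.execIn (i, j) t₀ (t₀ + 0) = 0 :=
    Finset.sum_eq_zero fun j _ => σ.execIn_eq_zero _ fun x hx hx' => by
      rw [add_zero] at hx'
      exact absurd hx' hx.not_gt
  have hex : ∃ q, d ≤ A.release i q :=
    let ⟨q, hq⟩ := A.exists_le_release d
    ⟨q, hq i q le_rfl⟩
  classical
  -- The first release at or after `d`; its predecessor, if any, is the last release before `d`, and
  -- `y` is the offset of that one if it lies in the window and `0` otherwise.
  obtain ⟨q, hq, hqmin⟩ : ∃ q, d ≤ A.release i q ∧ ∀ j < q, A.release i j < d :=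
    ⟨Nat.find hex, Nat.find_spec hex, fun j hj => not_le.1 (Nat.find_min hex hj)⟩
  have hsum := htrunc q d hq
  rcases q with _ | q
  · refine ⟨0, le_rfl, by linarith, by rw [hzero, mul_zero], hsum.trans ?_⟩
    simpa using (τ.C_pos i).le
  · have hqd := hqmin q (Nat.lt_succ_self q)
    rw [Finset.sum_range_succ] at hsum
    have hlast := hjob' q d hd
    rcases le_or_gt t₀ (A.release i q) with hq' | hq'
    · refine ⟨A.release i q - t₀, sub_nonneg.2 hq', by linarith, ?_, ?_⟩
      · rw [add_sub_cancel]
        exact (htrunc q _ le_rfl).trans (hfluid q hq' _ hq')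
      · linarith [hfluid q hq' d hd]
    · refine ⟨0, le_rfl, by linarith, by rw [hzero, mul_zero], ?_⟩
      have h0 : ∑ j ∈ Finset.range q, σ.execIn (i, j) t₀ d = 0 :=
        Finset.sum_eq_zero fun j hj => h.execIn_eq_zero_of_finished zero_le_one ht₀
          (hprev j q (Finset.mem_range.1 hj) t₀ hq'.le)
      linarith

/-- While a ready job of a task up to `k` waits, every processor runs a job of a task before `k`.
Such a job was released before `d`, so its number is below `N` and a finite set of jobs accounts for
all this work. -/
theorem IsGlobalFixedPriority.le_work (h : σ.IsGlobalFixedPriority 1 A) {k : Fin n} {N : ℕ} {d : ℝ}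
    (hN : ∀ i, ∀ j ≥ N, d ≤ A.release i j) {J : Job n} (hJk : J.1 ≤ k) {a b : ℝ} (ha : 0 ≤ a)
    (hab : a ≤ b) (hbd : b ≤ d) (hready : ∀ x ∈ Set.Ico a b, σ.Ready 1 A J x) :
    M * (b - a - σ.execIn J a b) ≤
      ∑ J' ∈ Finset.Iio k ×ˢ Finset.range N, σ.execIn J' a b := by
  refine σ.le_sum_execIn _ J hab (fun x hx => (h.1 x (ha.trans hx.1)).2) fun x hx hr p => ?_
  have hx0 := ha.trans hx.1
  obtain ⟨J', hp, hlt⟩ := h.2 x hx0 J (hready x hx) hr p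
  refine ⟨J', Finset.mem_product.2 ⟨Finset.mem_Iio.2 (hlt.trans_le hJk), Finset.mem_range.2 ?_⟩, hp⟩
  by_contra! hJ'
  exact ((hN J'.1 J'.2 hJ').trans (h.1.ready hx0 ⟨p, hp⟩).1).not_gt (hx.2.trans_le hbd)

end Schedule

/-! ### Sufficiency of the test and the factor 3 -/

namespace TaskSystem

variable {n : ℕ} {τ : TaskSystem n} {M : ℕ}

/-- The window argument for the first deadline miss of task `k`. Timeliness of the earlier jobs of
`k` makes the missing job ready throughout `[r, d)`. -/
theorem PassesTest.finished_of_forall_lt {k : Fin n} (hM : 0 < M) (hpass : τ.PassesTest M k)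
    {σ : Schedule n M} {A : Arrivals τ} (hσ : σ.IsGlobalFixedPriority 1 A)
    (hhp : ∀ i < k, σ.TaskMeetsDeadlines 1 A i) (j : ℕ)
    (hj : ∀ j' < j, σ.Finished 1 A (k, j') (A.release k j' + τ.D k)) :
    σ.Finished 1 A (k, j) (A.release k j + τ.D k) := by
  by_contra hmiss
  have hM' : (0 : ℝ) < M := Nat.cast_pos.2 hM
  have hvalid := hσ.1
  have hDk := τ.D_pos k
  obtain ⟨hΔk, hΔ⟩ := (τ.deltaMax_le_iff k _).1 le_rfl
  obtain ⟨hU, -, hΔle⟩ := (τ.passesTest_iff M k).1 hpass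
  set δ := τ.deltaMax k
  set r := A.release k j
  set d := r + τ.D k
  have hr0 : 0 ≤ r := A.release_nonneg' k j
  have hrd : r < d := lt_add_of_pos_right r hDk
  obtain ⟨N, hN⟩ := A.exists_le_release d
  set S := Finset.Iio k ×ˢ Finset.range N with hS
  set W : ℝ → ℝ → ℝ := fun a b => ∑ J ∈ S, σ.execIn J a b with hW
  have hWadd : ∀ a b c, a ≤ b → b ≤ c → W a b + W b c = W a c := fun a b c hab hbc => by
    simp only [hW, ← Finset.sum_add_distrib, σ.execIn_add _ hab hbc]
  -- more than a fraction `1 - δ` of the capacity is used in `[r, d)`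
  have hwindow : M * ((1 - δ) * (d - r)) < W r d := by
    have h1 := hσ.le_work hN (J := (k, j)) (le_refl k) hr0 hrd.le le_rfl fun x hx =>
      ⟨hx.1, fun hf => hmiss (hf.mono zero_le_one hx.2.le), fun j' hj' =>
        (hj j' hj').mono zero_le_one (by
          have : A.release k j' + τ.T k ≤ r := A.release_add_T_le hj'
          linarith [hx.1, τ.D_le_T k])⟩
    refine lt_of_lt_of_le (mul_lt_mul_of_pos_left ?_ hM') h1
    rw [Schedule.finished_one_iff, not_le] at hmiss
    have h2 := σ.execIn_le_execIn (k, j) hr0 (le_refl d)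
    have h3 : τ.C k ≤ δ * τ.D k := (div_le_iff₀ hDk).1 hΔk
    have h4 : d - r = τ.D k := add_sub_cancel_left r _
    have h5 := A.exec_le k j
    rw [h4]
    change σ.execIn (k, j) 0 d < A.exec k j at hmiss
    linarith
  -- the start of the window of interest
  obtain ⟨t₀, ⟨ht₀, ht₀r⟩, hmax⟩ := isCompact_Icc.exists_isMaxOn
    (s := Set.Icc 0 r) (f := fun t => M * ((1 - δ) * t) - W 0 t) ⟨0, le_rfl, hr0⟩ (by
      refine ContinuousOn.sub (by fun_prop) ?_
      exact continuousOn_finsetSum _ fun J _ =>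
        (σ.continuousOn_execIn J 0).mono Set.Icc_subset_Ici_self)
  have hmax' : ∀ t, 0 ≤ t → t ≤ r → M * ((1 - δ) * t) - W 0 t ≤ M * ((1 - δ) * t₀) - W 0 t₀ :=
    fun t h0 h1 => hmax ⟨h0, h1⟩
  have ht₀d : t₀ ≤ d := ht₀r.trans hrd.le
  -- Maximality of `t₀` compared with `r`: `[t₀, r)` carries at least the fraction `1 - δ`, so
  -- adjoining it preserves the overload.
  have hwork : M * ((1 - δ) * (d - t₀)) < W t₀ d := by
    have h1 := hmax' r hr0 le_rfl
    have h2 := hWadd 0 t₀ r ht₀ ht₀r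
    have h3 := hWadd t₀ r d ht₀r hrd.le
    nlinarith
  -- Maximality of `t₀` compared with the release: the load since then is at most the fraction `1 -
  -- δ`, so the pending job was blocked for at most that fraction of the time and ran for at least
  -- `δ ≥ U i`.
  have hcarry : ∀ i < k, ∀ j, A.release i j < t₀ → ¬ σ.Finished 1 A (i, j) t₀ →
      τ.U i * (t₀ - A.release i j) ≤ σ.execIn (i, j) 0 t₀ := by
    intro i hi j' hlt hf
    have hρ := A.release_nonneg' i j'
    have h1 := hσ.le_work hN (J := (i, j')) (k := k) hi.le hρ hlt.le ht₀d fun x hx =>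
      ⟨hx.1, fun hf' => hf (hf'.mono zero_le_one hx.2.le), fun l hl =>
        (hhp i hi l).mono zero_le_one (by
          linarith [A.release_add_T_le (i := i) hl, hx.1, τ.D_le_T i])⟩
    have h2 := hmax' _ hρ (hlt.le.trans ht₀r)
    have h3 := hWadd 0 _ t₀ hρ hlt.le
    have h4 := σ.execIn_le_execIn (i, j') hρ (le_refl t₀)
    have h5 : M * (t₀ - A.release i j' - σ.execIn (i, j') (A.release i j') t₀) ≤
        M * ((1 - δ) * (t₀ - A.release i j')) := by
      refine h1.trans ?_
      change W _ _ ≤ _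
      linarith
    have h6 := le_of_mul_le_mul_left h5 hM'
    have h7 := mul_le_mul_of_nonneg_right (hΔ i hi) (sub_nonneg.2 hlt.le)
    linarith
  -- The value `0` for tasks from `k` on only makes `y` a total function.
  have hy : ∀ i, ∃ y, i < k → 0 ≤ y ∧ t₀ + y ≤ d ∧
      ∑ j ∈ Finset.range N, σ.execIn (i, j) t₀ (t₀ + y) ≤ τ.U i * y ∧
      ∑ j ∈ Finset.range N, σ.execIn (i, j) t₀ d ≤ τ.C i + τ.U i * y := by
    intro i
    by_cases hi : i < k
    · obtain ⟨y, hy⟩ := hvalid.exists_work_bound (hhp i hi) ht₀ ht₀d (hcarry i hi) N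
      exact ⟨y, fun _ => hy⟩
    · exact ⟨0, fun h => absurd h hi⟩
  choose y hy using hy
  have hWsum : ∀ a b, W a b = ∑ i ∈ Finset.Iio k, ∑ j ∈ Finset.range N, σ.execIn (i, j) a b :=
    fun a b => by rw [hW, hS]; exact Finset.sum_product _ _ _
  refine (quadratic_bound (Finset.Iio k) τ.C τ.T y τ.C_pos τ.T_pos (δ := δ) hM' hDk
    (L := d - t₀) (by linarith [show d = r + τ.D k from rfl]) ?_ ?_ ?_).not_ge hΔle
  · have := τ.U_pos k
    exact lt_of_lt_of_le (lt_add_of_pos_right _ this) hU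
  · refine hwork.trans_le ?_
    rw [hWsum]
    exact Finset.sum_le_sum fun i hi => (hy i (Finset.mem_Iio.1 hi)).2.2.2
  · intro l hl
    obtain ⟨hl0, hld, -, -⟩ := hy l (Finset.mem_Iio.1 hl)
    have hl' : t₀ ≤ t₀ + y l := le_add_of_nonneg_right hl0
    have h1 := hWadd t₀ (t₀ + y l) d hl' hld
    have h2 : W (t₀ + y l) d ≤ M * (d - (t₀ + y l)) := σ.sum_execIn_le S hld
    have h3 : M * (y l - δ * (d - t₀)) ≤ W t₀ (t₀ + y l) := by linarith
    refine h3.trans ?_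
    rw [hWsum]
    refine Finset.sum_le_sum fun i hi => ?_
    obtain ⟨-, hid, h4, h5⟩ := hy i (Finset.mem_Iio.1 hi)
    -- If `y l ≤ y i`, only the fluid part of task `i` precedes `t₀ + y l`; otherwise its work in
    -- the whole window serves as the bound.
    split_ifs with hli
    · rw [zero_add]
      refine le_trans (Finset.sum_le_sum fun j _ => ?_) h4
      exact σ.execIn_le_execIn _ le_rfl (by linarith)
    · refine le_trans (Finset.sum_le_sum fun j _ => ?_) h5
      exact σ.execIn_le_execIn _ le_rfl hld

theorem PassesTest.taskSchedulable {k : Fin n} (hM : 0 < M) (hpass : τ.PassesTest M k)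
    (hhp : ∀ i < k, τ.TaskSchedulable M 1 i) : τ.TaskSchedulable M 1 k := by
  intro A σ hσ j
  induction j using Nat.strong_induction_on with
  | _ j ih => exact hpass.finished_of_forall_lt hM hσ (fun i hi => hhp i hi A σ hσ) j ih

theorem schedulable_of_forall_passesTest (hM : 0 < M) (hpass : ∀ k, τ.PassesTest M k) :
    τ.Schedulable M 1 := by
  intro k
  induction k using WellFoundedLT.induction with
  | ind k ih => exact (hpass k).taskSchedulable hM ih

/-- The pair sum is nonnegative and can be dropped, leaving 1 - 1/3 - 1/3 = 1/3 on the right. In the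
utilization condition, M/3 + 1/3 ≤ M because M ≥ 1. -/
theorem passesTest_of_le {k : Fin n} (hM : 0 < M) (h1 : τ.deltaMax k ≤ 1 / 3)
    (h2 : (∑ i ∈ Finset.Iio k, τ.U i) / (M : ℝ) ≤ 1 / 3)
    (h3 : (∑ i ∈ Finset.Iio k, τ.C i) / ((M : ℝ) * τ.D k) ≤ 1 / 3) : τ.PassesTest M k := by
  have hM1 : (1 : ℝ) ≤ M := Nat.one_le_cast.2 hM
  have hM' : (0 : ℝ) < M := zero_lt_one.trans_le hM1
  have hk := ((τ.deltaMax_le_iff k _).1 h1).1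
  have hP : 0 ≤ τ.pairSum k / τ.D k / 2 / (M * M) := by
    have := τ.pairSum_nonneg k
    have := τ.D_pos k
    positivity
  rw [mul_comm (M : ℝ), ← div_div] at h3
  rw [passesTest_iff, add_div]
  refine ⟨?_, ?_, by linarith⟩
  · rw [div_le_iff₀ hM'] at h2
    linarith [τ.U_le_density k]
  · rw [div_le_iff₀ hM'] at h3
    linarith

theorem CapacityConstraints.passesTest (hM : 0 < M) (h : τ.CapacityConstraints M 3) (k : Fin n) :
    τ.PassesTest M k := by
  obtain ⟨h1, h2, h3⟩ := h
  have hM' : (0 : ℝ) < M := Nat.cast_pos.2 hM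
  have hdens : ∀ i, τ.C i / τ.D i ≤ 1 / 3 := fun i => by
    simpa [min_eq_right (τ.D_le_T i)] using h3 i
  refine passesTest_of_le hM ?_ ?_ ?_
  · exact (τ.deltaMax_le_iff k _).2 ⟨hdens k, fun i _ => (τ.U_le_density i).trans (hdens i)⟩
  · refine le_trans ?_ h1
    rw [Finset.sum_div]
    refine (Finset.sum_le_sum_of_subset_of_nonneg (Finset.subset_univ _) fun i _ _ =>
      div_nonneg (τ.U_pos i).le hM'.le).trans_eq (Finset.sum_congr rfl fun i _ => ?_)
    rw [U, div_div, mul_comm]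
  · refine le_trans ?_ (h2 k)
    have := τ.D_pos k
    have := τ.C_pos k
    gcongr
    linarith

theorem Feasible.passesTest (hM : 0 < M) (hdm : τ.DeadlineMonotonic) (h : τ.Feasible M (1 / 3))
    (k : Fin n) : τ.PassesTest M k := by
  have hM' : (0 : ℝ) < M := Nat.cast_pos.2 hM
  have h3 : (0 : ℝ) ≤ 1 / 3 := by norm_num
  have hdens : ∀ i, τ.C i / τ.D i ≤ 1 / 3 := fun i => (div_le_iff₀ (τ.D_pos i)).2 (h.C_le h3 i)
  refine passesTest_of_le hM ?_ ((div_le_iff₀ hM').2 (h.sum_U_le h3 _))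
    ((div_le_iff₀ (mul_pos hM' (τ.D_pos k))).2 (h.sum_C_le h3 hdm k))
  exact (τ.deltaMax_le_iff k _).2 ⟨hdens k, fun i _ => (τ.U_le_density i).trans (hdens i)⟩

theorem Feasible.schedulable_three (hM : 0 < M) (hdm : τ.DeadlineMonotonic)
    (h : τ.Feasible M 1) : τ.Schedulable M 3 := by
  have ha : (0 : ℝ) < 1 / 3 := by norm_num
  have h1 := h.scaleExec ha
  rw [mul_one] at h1
  have h2 := schedulable_of_forall_passesTest hM
    (Feasible.passesTest (τ := τ.scaleExec (1 / 3) ha) hM hdm h1)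
  refine Schedulable.of_scaleExec ha (?_ : (τ.scaleExec (1 / 3) ha).Schedulable M (1 / 3 * 3))
  rwa [one_div_mul_cancel three_ne_zero]

end TaskSystem

end GlobalDM


theorem corollary4 :
    -- the test runs in polynomial time
    (∃ P : Program, P.DecidesTestInPolynomialTime) ∧
    ∀ (n : ℕ) (τ : TaskSystem n) (M : ℕ), 0 < M → τ.DeadlineMonotonic →
      -- it is a sufficient schedulability test for global DM
      (∀ k : Fin n, (∀ i < k, τ.TaskSchedulable M 1 i) → τ.PassesTest M k →
        τ.TaskSchedulable M 1 k) ∧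
      -- a task that fails the test violates one of three bounds
      (∀ k : Fin n, ¬ τ.PassesTest M k →
        1 / 3 < τ.deltaMax k ∨
        1 / 3 < (∑ i ∈ Finset.Iio k, τ.U i) / (M : ℝ) ∨
        1 / 3 < (∑ i ∈ Finset.Iio k, τ.C i) / ((M : ℝ) * τ.D k)) ∧
      -- capacity augmentation factor 3, by the test
      (τ.CapacityConstraints M 3 → (∀ k, τ.PassesTest M k) ∧ τ.Schedulable M 1) ∧
      -- speed-up factor 3 of the test
      ((∃ k, ¬ τ.PassesTest M k) → ¬ τ.Feasible M (1 / 3)) ∧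
      -- speed-up factor 3 of global DM
      (τ.Feasible M 1 → τ.Schedulable M 3) := by
  refine ⟨⟨_, Program.testProgram_decides⟩, fun n τ M hM hdm => ⟨fun k hhp hpass =>
    hpass.taskSchedulable hM hhp, fun k hfail => ?_, fun h => ?_, ?_, ?_⟩⟩
  · by_contra! h
    exact hfail (TaskSystem.passesTest_of_le hM h.1 h.2.1 h.2.2)
  · exact ⟨h.passesTest hM, TaskSystem.schedulable_of_forall_passesTest hM (h.passesTest hM)⟩
  · rintro ⟨k, hk⟩ h
    exact hk (h.passesTest hM hdm k)
  · exact fun h => h.schedulable_three hM hdm
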